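/- Let $m,n>3$ be integers with $m$ even, and let $\Sigma$ be an $m\times n$ signed grid: its underlying graph has vertex set $\{(i,j): 1\le i\le m,\ 1\le j\le n\}$, with edges joining $(i,j)$ to $(i,j+1)$ for $j<n$ and $(i,j)$ to $(i+1,j)$ for $i<m$, and every edge $e$ carries an arbitrary sign $\sigma(e)\in\{+1,-1\}$. For $1\le i\le m-1$ and $1\le j\le n-1$, the box $[i,j]$ is the unit square with vertices $(i,j),(i,j+1),(i+1,j),(i+1,j+1)$; its sign is the product of the signs of its four edges. The corner boxes are $[1,1]$, $[1,n-1]$, $[m-1,1]$ and $[m-1,n-1]$. A Hamiltonian circle is a cycle of the grid through all of its vertices, and its sign is the product of the signs of its edges. Then all Hamiltonian circles of $\Sigma$ have the same sign if and only if all boxes of $\Sigma$ other than the four corner boxes have the same sign. -/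

import Mathlib

open SimpleGraph

namespace SignedGrid

/-- The `m × n` grid graph: vertices are the pairs `(i, j)` with `i < m` and `j < n`, and two
vertices are adjacent exactly when they agree in one coordinate and differ by one in the other. -/
abbrev grid (m n : ℕ) : SimpleGraph (Fin m × Fin n) :=
  pathGraph m □ pathGraph n

/-- A signature of a graph: every edge is given a sign `1` or `-1`. -/
abbrev Signature {V : Type*} (G : SimpleGraph V) : Type _ :=
  G.edgeSet → ℤˣ

/-- The sign of a walk: the product of the signs of the edges it traverses. (A circle traverses
each of its edges exactly once, so this is the product over the edges of the circle.) -/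
def walkSign {V : Type*} {G : SimpleGraph V} (σ : Signature G) {u v : V} (p : G.Walk u v) : ℤˣ :=
  (p.edges.attach.map fun e => σ ⟨e.1, p.edges_subset_edgeSet e.2⟩).prod

/-- All Hamiltonian circles of the signed graph `(G, σ)` have the same sign. -/
def AllHamiltonianSameSign {V : Type*} [DecidableEq V] {G : SimpleGraph V}
    (σ : Signature G) : Prop :=
  ∀ (u v : V) (p : G.Walk u u) (q : G.Walk v v),
    p.IsHamiltonianCycle → q.IsHamiltonianCycle → walkSign σ p = walkSign σ q

/-- The horizontal edge joining `(i, j)` and `(i, j + 1)`. -/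
def hEdge {m n : ℕ} (i j : ℕ) (hi : i < m) (hj : j + 1 < n) : (grid m n).edgeSet :=
  ⟨s((⟨i, hi⟩, ⟨j, Nat.lt_of_succ_lt hj⟩), (⟨i, hi⟩, ⟨j + 1, hj⟩)), by
    simp [grid, boxProd_adj, pathGraph_adj]⟩

/-- The vertical edge joining `(i, j)` and `(i + 1, j)`. -/
def vEdge {m n : ℕ} (i j : ℕ) (hi : i + 1 < m) (hj : j < n) : (grid m n).edgeSet :=
  ⟨s((⟨i, Nat.lt_of_succ_lt hi⟩, ⟨j, hj⟩), (⟨i + 1, hi⟩, ⟨j, hj⟩)), by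
    simp [grid, boxProd_adj, pathGraph_adj]⟩

/-- The unit boxes of the `m × n` grid. The box `(i, j)` is the one with the
vertices `(i, j)`, `(i, j + 1)`, `(i + 1, j)`, `(i + 1, j + 1)`. -/
abbrev Box (m n : ℕ) : Type :=
  Fin (m - 1) × Fin (n - 1)

/-- The sign of a box: the product of the signs of its four boundary edges. -/
def boxSign {m n : ℕ} (σ : Signature (grid m n)) (b : Box m n) : ℤˣ :=
  have hi : b.1.val + 1 < m := Nat.add_lt_of_lt_sub b.1.isLt
  have hj : b.2.val + 1 < n := Nat.add_lt_of_lt_sub b.2.isLt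
  σ (hEdge b.1 b.2 (Nat.lt_of_succ_lt hi) hj) * σ (hEdge (b.1 + 1) b.2 hi hj) *
    (σ (vEdge b.1 b.2 hi (Nat.lt_of_succ_lt hj)) * σ (vEdge b.1 (b.2 + 1) hi hj))

/-- The four corner boxes: first or last row of boxes, and first or last column of boxes. -/
def IsCorner {m n : ℕ} (b : Box m n) : Prop :=
  (b.1.val = 0 ∨ b.1.val + 1 = m - 1) ∧ (b.2.val = 0 ∨ b.2.val + 1 = n - 1)

end SignedGrid

namespace SignedGrid

open Finset

/-! The sign of a circle is the product of the signs of the boxes it encloses, since each edge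
inside it is counted twice. Both directions compare sets of enclosed boxes.

If the non-corner boxes agree: a Hamiltonian circle encloses exactly half as many boxes as there are
vertices, less one (`two_mul_card_boxesOf`), and always the four corner boxes (`interior_corner`).
Its sign is therefore the product of the corner signs times a fixed power of the common sign
(`sum_edges_eq`). The enclosed boxes are defined algebraically by parity, so no Jordan curve theorem
is needed. The count comes from linear algebra over `ZMod 2`. A cochain supported on the chords on
one side of the circle is determined by its coboundary on the boxes of that side, because a closed
cochain vanishing on a connected spanning subgraph is zero. So chords are at most as many as boxes
on each side, and strictly fewer inside, where coboundaries sum to zero. Comparison with the totals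
turns these bounds into equalities.

Conversely, a tree-like set of boxes, in which each new box brings two new vertices, is bounded by a
cycle (`Grown.exists_boundary`). If it meets every vertex, the cycle is Hamiltonian. Since the
number of vertex rows is even, a comb of alternate full box rows joined in column 0 is such a set.
Replacing one or two boxes of the comb by as many others gives further Hamiltonian circles, and
equality of their signs equates the products of the exchanged boxes (`prod_eq_of_isHamiltonianSet`).
Five exchanges suffice to reach every non-corner box. -/

/-- Summation by parts: a combination of boxes paired with an edge weight. -/
theorem sum_boundary_mul {R : Type*} [CommSemiring R] (M N : ℕ) (b th tv : ℕ → ℕ → R)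
    (b_top : ∀ j, b 0 j = 0) (b_left : ∀ i, b i 0 = 0)
    (b_bot : ∀ j < N, b (M + 1) (j + 1) = 0) (b_right : ∀ i, b i (N + 1) = 0) :
    ∑ i ∈ range (M + 1), ∑ j ∈ range N, (b i (j + 1) + b (i + 1) (j + 1)) * th i j +
      ∑ i ∈ range M, ∑ j ∈ range (N + 1), (b (i + 1) j + b (i + 1) (j + 1)) * tv i j =
    ∑ i ∈ range M, ∑ j ∈ range N,
      b (i + 1) (j + 1) * (th i j + th (i + 1) j + (tv i j + tv i (j + 1))) := by
  have h1 : ∑ i ∈ range (M + 1), ∑ j ∈ range N, (b i (j + 1) + b (i + 1) (j + 1)) * th i j =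
      ∑ i ∈ range M, ∑ j ∈ range N, b (i + 1) (j + 1) * (th i j + th (i + 1) j) := by
    simp only [add_mul, mul_add, sum_add_distrib]
    rw [sum_range_succ' (fun i => ∑ j ∈ range N, b i (j + 1) * th i j),
      sum_range_succ (fun i => ∑ j ∈ range N, b (i + 1) (j + 1) * th i j)]
    have hb : ∑ j ∈ range N, b (M + 1) (j + 1) * th M j = 0 :=
      sum_eq_zero fun j hj => by rw [b_bot j (mem_range.1 hj), zero_mul]
    simp [b_top, hb, add_comm]
  have h2 : ∑ i ∈ range M, ∑ j ∈ range (N + 1), (b (i + 1) j + b (i + 1) (j + 1)) * tv i j =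
      ∑ i ∈ range M, ∑ j ∈ range N, b (i + 1) (j + 1) * (tv i j + tv i (j + 1)) := by
    refine sum_congr rfl fun i _ => ?_
    simp only [add_mul, mul_add, sum_add_distrib]
    rw [sum_range_succ' (fun j => b (i + 1) j * tv i j),
      sum_range_succ (fun j => b (i + 1) (j + 1) * tv i j)]
    simp [b_left, b_right, add_comm]
  rw [h1, h2, ← sum_add_distrib]
  refine sum_congr rfl fun i _ => ?_
  rw [← sum_add_distrib]
  exact sum_congr rfl fun j _ => by ring

/-! ### Spanning circles and their interiors modulo two -/

/-- A set of edges of the grid with vertices `(i, j)`, `i ≤ M`, `j ≤ N`, which has degree two at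
every vertex and is connected. The entry `ch i (j + 1)` counts the edge from `(i, j)` to
`(i, j + 1)`, and `cv (i + 1) j` the edge from `(i, j)` to `(i + 1, j)`. -/
structure IsSpanningCircle (M N : ℕ) (ch cv : ℕ → ℕ → ℕ) : Prop where
  ch_le : ∀ i j, ch i j ≤ 1
  cv_le : ∀ i j, cv i j ≤ 1
  left : ∀ i, ch i 0 = 0
  right : ∀ i, ch i (N + 1) = 0
  top : ∀ j, cv 0 j = 0
  bot : ∀ j, cv (M + 1) j = 0
  deg : ∀ i j, i ≤ M → j ≤ N → ch i j + ch i (j + 1) + cv i j + cv (i + 1) j = 2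
  conn : ∀ S : ℕ → ℕ → ZMod 2,
    (∀ i j, i ≤ M → j < N → ch i (j + 1) = 1 → S i j = S i (j + 1)) →
    (∀ i j, i < M → j ≤ N → cv (i + 1) j = 1 → S i j = S (i + 1) j) →
    ∀ i j, i ≤ M → j ≤ N → S i j = S 0 0

/-- The indicator modulo two of the boxes enclosed by a circle; the box with least vertex
`(i, j)` has index `(i + 1, j + 1)`. -/
def interior (ch : ℕ → ℕ → ℕ) (i j : ℕ) : ZMod 2 := ∑ k ∈ range i, (ch k j : ZMod 2)

theorem zmod_two_eq_zero_or_one (x : ZMod 2) : x = 0 ∨ x = 1 := by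
  revert x; decide

namespace IsSpanningCircle

variable {M N : ℕ} {ch cv : ℕ → ℕ → ℕ}

/-- With the next lemma: the boundary of the interior is the circle. Crossing a horizontal edge adds
exactly its own term to the sum defining `interior`. -/
theorem interior_add_succ_left (ch : ℕ → ℕ → ℕ) (i j : ℕ) :
    interior ch i j + interior ch (i + 1) j = ch i j := by
  simp only [interior, sum_range_succ]
  linear_combination (CharTwo.two_eq_zero (R := ZMod 2)) * ∑ k ∈ range i, (ch k j : ZMod 2)

/-- Induction down the column: the degree at each vertex is even, so if three of its edges satisfy
the boundary relation, the one below does too. -/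
theorem interior_add_succ_right (h : IsSpanningCircle M N ch cv) {i j : ℕ} (hi : i ≤ M + 1)
    (hj : j ≤ N) : interior ch i j + interior ch i (j + 1) = cv i j := by
  induction i with
  | zero => simp [interior, h.top]
  | succ i ih =>
    have h1 := interior_add_succ_left ch i j
    have h2 := interior_add_succ_left ch i (j + 1)
    have h3 := ih (by omega)
    have h4 : ((ch i j + ch i (j + 1) + cv i j + cv (i + 1) j : ℕ) : ZMod 2) = (2 : ℕ) := by
      rw [h.deg i j (by omega) hj]
    push_cast at h4
    linear_combination h1 + h2 + h3 - h4 + (CharTwo.two_eq_zero (R := ZMod 2)) *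
      (ch i j + ch i (j + 1) + cv i j - interior ch i j - interior ch i (j + 1) - 1)

theorem interior_left (h : IsSpanningCircle M N ch cv) (i : ℕ) : interior ch i 0 = 0 := by
  simp [interior, h.left]

theorem interior_right (h : IsSpanningCircle M N ch cv) (i : ℕ) : interior ch i (N + 1) = 0 := by
  simp [interior, h.right]

/-- Zero on the left and unchanged from column to column, because no vertical edge leaves the last
row downwards. -/
theorem interior_bot (h : IsSpanningCircle M N ch cv) {j : ℕ} (hj : j ≤ N + 1) :
    interior ch (M + 1) j = 0 := by
  induction j with
  | zero => exact h.interior_left _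
  | succ j ih =>
    have := h.interior_add_succ_right le_rfl (by omega : j ≤ N)
    rw [ih (by omega), h.bot] at this
    simpa using this

/-- The number of edges of a spanning circle is the number of vertices. -/
theorem sum_edges (h : IsSpanningCircle M N ch cv) :
    ∑ i ∈ range (M + 1), ∑ j ∈ range N, ch i (j + 1) +
      ∑ i ∈ range M, ∑ j ∈ range (N + 1), cv (i + 1) j = (M + 1) * (N + 1) := by
  have hdeg : ∑ i ∈ range (M + 1), ∑ j ∈ range (N + 1),
      (ch i j + ch i (j + 1) + (cv i j + cv (i + 1) j)) = (M + 1) * (N + 1) * 2 := by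
    rw [sum_congr rfl fun i hi => sum_congr rfl fun j hj => by
      rw [← add_assoc, h.deg i j (by simp at hi; omega) (by simp at hj; omega)]]
    simp [mul_assoc]
  have h1 : ∀ i, ∑ j ∈ range (N + 1), (ch i j + ch i (j + 1)) =
      2 * ∑ j ∈ range N, ch i (j + 1) := fun i => by
    rw [sum_add_distrib, sum_range_succ', sum_range_succ (fun j => ch i (j + 1)), h.left, h.right]
    ring
  have h2 : ∑ i ∈ range (M + 1), ∑ j ∈ range (N + 1), (cv i j + cv (i + 1) j) =
      2 * ∑ i ∈ range M, ∑ j ∈ range (N + 1), cv (i + 1) j := by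
    simp only [sum_add_distrib]
    rw [sum_range_succ' (fun i => ∑ j ∈ range (N + 1), cv i j),
      sum_range_succ (fun i => ∑ j ∈ range (N + 1), cv (i + 1) j)]
    simp only [h.top, h.bot, sum_const_zero]
    ring
  simp only [sum_add_distrib (f := fun j => ch _ j + ch _ (j + 1))] at hdeg
  rw [sum_add_distrib, h2] at hdeg
  simp only [h1, ← mul_sum] at hdeg
  omega

/-! ### Counting chords and enclosed boxes -/

/-- A closed edge weight which vanishes on a spanning circle vanishes everywhere. -/
theorem eq_zero_of_closed (h : IsSpanningCircle M N ch cv) (dh dv : ℕ → ℕ → ZMod 2)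
    (hh : ∀ i j, i ≤ M → j < N → ch i (j + 1) = 1 → dh i j = 0)
    (hv : ∀ i j, i < M → j ≤ N → cv (i + 1) j = 1 → dv i j = 0)
    (hd : ∀ i j, i < M → j < N → dh i j + dh (i + 1) j + (dv i j + dv i (j + 1)) = 0) :
    (∀ i j, i ≤ M → j < N → dh i j = 0) ∧ (∀ i j, i < M → j ≤ N → dv i j = 0) := by
  -- A potential for the weight: integrate down column 0, then along row `i`. Closedness makes it a
  -- potential for the vertical edges of the other columns too, and `conn` makes it constant.
  set S : ℕ → ℕ → ZMod 2 := fun i j => ∑ k ∈ range i, dv k 0 + ∑ k ∈ range j, dh i k with hS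
  have Sh : ∀ i j, S i (j + 1) = S i j + dh i j := fun i j => by
    simp only [hS, sum_range_succ]; ring
  have Sv : ∀ i j, i < M → j ≤ N → S (i + 1) j = S i j + dv i j := by
    intro i j hi hj
    induction j with
    | zero => simp [hS, sum_range_succ]
    | succ j ih =>
      rw [Sh, Sh, ih (by omega)]
      have := hd i j hi (by omega)
      linear_combination this - (CharTwo.two_eq_zero (R := ZMod 2)) * (dh i j + dv i (j + 1))
  have hc := h.conn S (fun i j hi hj hc => by rw [Sh, hh i j hi hj hc, add_zero])
    (fun i j hi hj hc => by rw [Sv i j hi hj, hv i j hi hj hc, add_zero])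
  constructor
  · intro i j hi hj
    have := Sh i j
    rw [hc i j hi hj.le, hc i (j + 1) hi hj] at this
    simpa using this
  · intro i j hi hj
    have := Sv i j hi hj
    rw [hc i j hi.le hj, hc (i + 1) j hi hj] at this
    simpa using this

variable (M N ch cv) in
/-- Horizontal edges off the circle whose sides have interior indicator `v`. -/
def hChords (v : ZMod 2) : Finset (ℕ × ℕ) :=
  {x ∈ range (M + 1) ×ˢ range N | ch x.1 (x.2 + 1) = 0 ∧ interior ch x.1 (x.2 + 1) = v}

variable (M N ch cv) in
/-- Vertical edges off the circle whose sides have interior indicator `v`. -/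
def vChords (v : ZMod 2) : Finset (ℕ × ℕ) :=
  {x ∈ range M ×ˢ range (N + 1) | cv (x.1 + 1) x.2 = 0 ∧ interior ch (x.1 + 1) x.2 = v}

variable (M N ch) in
/-- Boxes with interior indicator `v`. -/
def boxesOf (v : ZMod 2) : Finset (ℕ × ℕ) :=
  {x ∈ range M ×ˢ range N | interior ch (x.1 + 1) (x.2 + 1) = v}

/-- Extension of a family by zero. -/
def extendZero {s : Finset (ℕ × ℕ)} (d : s → ZMod 2) (i j : ℕ) : ZMod 2 :=
  if h : (i, j) ∈ s then d ⟨(i, j), h⟩ else 0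

theorem extendZero_of_notMem {s : Finset (ℕ × ℕ)} (d : s → ZMod 2) {i j : ℕ} (h : (i, j) ∉ s) :
    extendZero d i j = 0 := dif_neg h

variable (M N ch cv) in
/-- The coboundary of a family on the chords with sides of indicator `v`. -/
def chordMap (v : ZMod 2)
    (d : (hChords M N ch v → ZMod 2) × (vChords M N ch cv v → ZMod 2)) :
    boxesOf M N ch v → ZMod 2 := fun x =>
  extendZero d.1 x.1.1 x.1.2 + extendZero d.1 (x.1.1 + 1) x.1.2 +
    (extendZero d.2 x.1.1 x.1.2 + extendZero d.2 x.1.1 (x.1.2 + 1))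

theorem chordMap_sub (v : ZMod 2)
    (d e : (hChords M N ch v → ZMod 2) × (vChords M N ch cv v → ZMod 2)) :
    chordMap M N ch cv v (d - e) = chordMap M N ch cv v d - chordMap M N ch cv v e := by
  have : ∀ (s : Finset (ℕ × ℕ)) (d e : s → ZMod 2) (i j : ℕ),
      extendZero (d - e) i j = extendZero d i j - extendZero e i j := fun s d e i j => by
    unfold extendZero; split_ifs <;> simp
  funext x
  simp only [chordMap, Prod.fst_sub, Prod.snd_sub, this, Pi.sub_apply]
  ring

/-- A family in the kernel, extended by zero, is closed at every box and vanishes on the circle, so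
`eq_zero_of_closed` kills it. -/
theorem chordMap_injective (h : IsSpanningCircle M N ch cv) (v : ZMod 2) :
    Function.Injective (chordMap M N ch cv v) := by
  have key : ∀ d, chordMap M N ch cv v d = 0 → d = 0 := by
    intro d hd
    have hz := h.eq_zero_of_closed (extendZero d.1) (extendZero d.2)
      (fun i j _ _ hc => extendZero_of_notMem _ (by simp [hChords, hc]))
      (fun i j _ _ hc => extendZero_of_notMem _ (by simp [vChords, hc])) ?_
    · ext ⟨⟨i, j⟩, hx⟩
      · have := hx
        simp only [hChords, mem_filter, mem_product, mem_range] at this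
        simpa [extendZero, hx] using hz.1 i j (by omega) (by omega)
      · have := hx
        simp only [vChords, mem_filter, mem_product, mem_range] at this
        simpa [extendZero, hx] using hz.2 i j (by omega) (by omega)
    · intro i j hi hj
      by_cases hb : interior ch (i + 1) (j + 1) = v
      · exact congrFun hd ⟨(i, j), by simp [boxesOf, hi, hj, hb]⟩
      -- Both sides of a chord have the same indicator, so no chord of the family borders a box of
      -- the other kind.
      · rw [extendZero_of_notMem _, extendZero_of_notMem _, extendZero_of_notMem _,
          extendZero_of_notMem _]
        · simp
        · simp [vChords, hb]
        · simp only [vChords, mem_filter, not_and]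
          intro _ hc hb'
          have := h.interior_add_succ_right (i := i + 1) (j := j) (by omega) (by omega)
          rw [hc, Nat.cast_zero, CharTwo.add_eq_zero] at this
          exact hb (this ▸ hb')
        · simp [hChords, hb]
        · simp only [hChords, mem_filter, not_and]
          intro _ hc hb'
          have := interior_add_succ_left ch i (j + 1)
          rw [hc, Nat.cast_zero, CharTwo.add_eq_zero] at this
          exact hb (this ▸ hb')
  intro d e hde
  exact sub_eq_zero.1 (key _ (by rw [chordMap_sub, hde, sub_self]))

/-- Compare the cardinalities of the two `ZMod 2` function spaces, which are powers of two. -/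
theorem card_chords_le (h : IsSpanningCircle M N ch cv) (v : ZMod 2) :
    #(hChords M N ch v) + #(vChords M N ch cv v) ≤ #(boxesOf M N ch v) := by
  have := Fintype.card_le_of_injective _ (h.chordMap_injective v)
  simp only [Fintype.card_prod, Fintype.card_fun, ZMod.card, Fintype.card_coe, ← pow_add] at this
  exact (Nat.pow_le_pow_iff_right (by norm_num)).1 this

/-- The chords inside the circle are fewer than the boxes inside the circle. -/
theorem card_chords_lt (h : IsSpanningCircle M N ch cv) (hB : (boxesOf M N ch 1).Nonempty) :
    #(hChords M N ch 1) + #(vChords M N ch cv 1) < #(boxesOf M N ch 1) := by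
  -- Summing the coboundary over the inside pairs the family with the boundary of the inside. That
  -- is the circle, where the family is zero.
  have hsum : ∀ d, ∑ x, chordMap M N ch cv 1 d x = 0 := by
    intro d
    have hs := sum_boundary_mul M N (interior ch) (extendZero d.1) (extendZero d.2)
      (by simp [interior]) h.interior_left (fun j hj => h.interior_bot (by omega))
      h.interior_right
    have hL : ∀ i j, (ch i (j + 1) : ZMod 2) * extendZero d.1 i j = 0 := fun i j => by
      by_cases hc : ch i (j + 1) = 0
      · simp [hc]
      · rw [extendZero_of_notMem _ (by simp [hChords, hc]), mul_zero]
    have hR : ∀ i j, (cv (i + 1) j : ZMod 2) * extendZero d.2 i j = 0 := fun i j => by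
      by_cases hc : cv (i + 1) j = 0
      · simp [hc]
      · rw [extendZero_of_notMem _ (by simp [vChords, hc]), mul_zero]
    rw [sum_congr rfl fun i _ => sum_congr rfl fun j _ => by
        rw [interior_add_succ_left, hL],
      sum_congr (s₁ := range M) rfl fun i hi => sum_congr rfl fun j hj => by
        rw [h.interior_add_succ_right (by simp at hi; omega) (by simp at hj; omega), hR]] at hs
    simp only [sum_const_zero, add_zero] at hs
    rw [← sum_product', eq_comm] at hs
    rw [← hs, univ_eq_attach, ← sum_filter_add_sum_filter_not (range M ×ˢ range N)
      (fun x => interior ch (x.1 + 1) (x.2 + 1) = 1)]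
    rw [sum_eq_zero (s := filter (fun x : ℕ × ℕ => ¬ interior ch (x.1 + 1) (x.2 + 1) = 1) _),
      add_zero]
    · rw [← sum_coe_sort (filter _ _)]
      refine sum_congr rfl fun x _ => ?_
      rw [(mem_filter.1 x.2).2, one_mul]
      rfl
    · intro x hx
      rw [((zmod_two_eq_zero_or_one _).resolve_right (mem_filter.1 hx).2), zero_mul]
  -- The indicator of a single inside box has sum one, so it is not a coboundary.
  have hns : ¬ Function.Surjective (chordMap M N ch cv 1) := by
    intro hsurj
    obtain ⟨x, hx⟩ := hB
    obtain ⟨d, hd⟩ := hsurj (Pi.single ⟨x, hx⟩ 1)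
    have := hsum d
    rw [hd] at this
    simp at this
  have := Fintype.card_lt_of_injective_not_surjective _ (h.chordMap_injective 1) hns
  simp only [Fintype.card_prod, Fintype.card_fun, ZMod.card, Fintype.card_coe, ← pow_add] at this
  exact (Nat.pow_lt_pow_iff_right (by norm_num)).1 this

theorem card_hChords (v : ZMod 2) : #(hChords M N ch v) = ∑ i ∈ range (M + 1), ∑ j ∈ range N,
    if ch i (j + 1) = 0 ∧ interior ch i (j + 1) = v then 1 else 0 := by
  rw [hChords, card_filter, sum_product]

theorem card_vChords (v : ZMod 2) : #(vChords M N ch cv v) = ∑ i ∈ range M,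
    ∑ j ∈ range (N + 1), if cv (i + 1) j = 0 ∧ interior ch (i + 1) j = v then 1 else 0 := by
  rw [vChords, card_filter, sum_product]

theorem card_boxesOf (v : ZMod 2) : #(boxesOf M N ch v) = ∑ i ∈ range M, ∑ j ∈ range N,
    if interior ch (i + 1) (j + 1) = v then 1 else 0 := by
  rw [boxesOf, card_filter, sum_product]

/-- Pick's formula: a spanning circle of the grid encloses half as many boxes as there are
vertices, less one. -/
theorem two_mul_card_boxesOf (h : IsSpanningCircle M N ch cv)
    (hB : (boxesOf M N ch 1).Nonempty) : 2 * #(boxesOf M N ch 1) + 2 = (M + 1) * (N + 1) := by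
  -- An edge of the circle has one side inside; a chord has both or neither.
  have side : ∀ (x y : ZMod 2) (c : ℕ), c ≤ 1 → x + y = c →
      (if x = 1 then 1 else 0) + (if y = 1 then 1 else 0) =
        c + 2 * (if c = 0 ∧ x = 1 then 1 else 0) := by
    intro x y c hc
    interval_cases c <;> revert x y <;> decide
  have total : ∀ (x : ZMod 2) (c : ℕ), c ≤ 1 →
      c + ((if c = 0 ∧ x = 0 then 1 else 0) + (if c = 0 ∧ x = 1 then 1 else 0)) = 1 := by
    intro x c hc
    interval_cases c <;> revert x <;> decide
  -- Incidences of edges with inside boxes, counted in two ways: four for each box.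
  have h4 := sum_boundary_mul M N (fun i j => if interior ch i j = 1 then 1 else 0)
    (fun _ _ => 1) (fun _ _ => 1) (by simp [interior]) (by simp [h.interior_left])
    (fun j hj => by simp [h.interior_bot (by omega : j + 1 ≤ N + 1)])
    (by simp [h.interior_right])
  simp only [mul_one, ← sum_mul, ← card_boxesOf] at h4
  rw [sum_congr rfl fun i _ => sum_congr rfl fun j _ =>
      side _ _ _ (h.ch_le i (j + 1)) (interior_add_succ_left ch i (j + 1)),
    sum_congr (s₁ := range M) rfl fun i hi => sum_congr rfl fun j hj =>
      side _ _ _ (h.cv_le (i + 1) j) (h.interior_add_succ_right (by simp at hi; omega)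
        (by simp at hj; omega))] at h4
  simp only [sum_add_distrib, ← mul_sum, ← card_hChords, ← card_vChords] at h4
  have hh : ∑ i ∈ range (M + 1), ∑ j ∈ range N, ch i (j + 1) +
      (#(hChords M N ch 0) + #(hChords M N ch 1)) = (M + 1) * N := by
    simp only [card_hChords, ← sum_add_distrib]
    rw [sum_congr rfl fun i _ => sum_congr rfl fun j _ => total _ _ (h.ch_le i (j + 1))]
    simp
  have hv : ∑ i ∈ range M, ∑ j ∈ range (N + 1), cv (i + 1) j +
      (#(vChords M N ch cv 0) + #(vChords M N ch cv 1)) = M * (N + 1) := by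
    simp only [card_vChords, ← sum_add_distrib]
    rw [sum_congr rfl fun i _ => sum_congr rfl fun j _ => total _ _ (h.cv_le (i + 1) j)]
    simp
  have hb : #(boxesOf M N ch 0) + #(boxesOf M N ch 1) = M * N := by
    simp only [card_boxesOf, ← sum_add_distrib]
    rw [sum_congr rfl fun i _ => sum_congr rfl fun j _ =>
      (by decide : ∀ x : ZMod 2, ((if x = 0 then 1 else 0) + (if x = 1 then 1 else 0) : ℕ) = 1) _]
    simp
  -- Let `V` be the number of vertices, `c₀`, `c₁` the chords and `b₀`, `b₁` the boxes outside and
  -- inside. The totals give `c₀ + c₁ = b₀ + b₁ - 1`, so `c₀ ≤ b₀` and `c₁ < b₁` force `c₁ = b₁ -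
  -- 1`. Then `4 b₁ = V + 2 c₁` gives the formula.
  have he := h.sum_edges
  have h0 := h.card_chords_le 0
  have h1 := h.card_chords_lt hB
  have e1 : (M + 1) * (N + 1) = M * N + M + N + 1 := by ring
  have e2 : (M + 1) * N = M * N + N := by ring
  have e3 : M * (N + 1) = M * N + M := by ring
  rw [e1] at he ⊢
  rw [e2] at hh
  rw [e3] at hv
  omega

/-- The corner boxes lie inside every spanning circle. -/
theorem interior_corner (h : IsSpanningCircle M N ch cv) {i j : ℕ} (hi : i = 0 ∨ i + 1 = M)
    (hj : j = 0 ∨ j + 1 = N) : interior ch (i + 1) (j + 1) = 1 := by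
  -- A corner vertex has only two edges in the grid, so the circle uses both.
  have key : ∀ k, k = 0 ∨ k = M → ch k (j + 1) = 1 := by
    intro k hk
    have h1 := h.ch_le k (j + 1)
    have h2 : ∀ l, cv k l + cv (k + 1) l ≤ 1 := fun l => by
      have := h.cv_le k l; have := h.cv_le (k + 1) l
      have := h.top l; have := h.bot l
      rcases hk with rfl | rfl <;> omega
    have hkM : k ≤ M := by omega
    rcases hj with rfl | rfl
    · have := h.deg k 0 hkM (by omega); have := h2 0; have := h.left k
      omega
    · have := h.deg k (j + 1) hkM le_rfl; have := h2 (j + 1); have := h.right k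
      omega
  rcases hi with rfl | rfl
  · simp [interior, key 0]
  · have := interior_add_succ_left ch (i + 1) (j + 1)
    rw [h.interior_bot (by omega), key _ (Or.inr rfl)] at this
    simpa using this

/-- If an edge weight has the same value on all boxes except the corners, its sum over a spanning
circle does not depend on the circle. -/
theorem sum_edges_eq (h : IsSpanningCircle M N ch cv) (hM : 0 < M) (hN : 0 < N)
    (th tv : ℕ → ℕ → ZMod 2) (s : ZMod 2)
    (ht : ∀ i j, i < M → j < N → ¬ ((i = 0 ∨ i + 1 = M) ∧ (j = 0 ∨ j + 1 = N)) →
      th i j + th (i + 1) j + (tv i j + tv i (j + 1)) = s) :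
    ∑ i ∈ range (M + 1), ∑ j ∈ range N, ch i (j + 1) * th i j +
      ∑ i ∈ range M, ∑ j ∈ range (N + 1), cv (i + 1) j * tv i j =
    ∑ i ∈ range M, ∑ j ∈ range N, (th i j + th (i + 1) j + (tv i j + tv i (j + 1)) - s) +
      (((M + 1) * (N + 1) - 2) / 2 : ℕ) * s := by
  have hs := sum_boundary_mul M N (interior ch) th tv
      (by simp [interior]) h.interior_left (fun j hj => h.interior_bot (by omega))
      h.interior_right
  rw [sum_congr rfl fun i _ => sum_congr rfl fun j _ => by
      rw [interior_add_succ_left],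
    sum_congr (s₁ := range M) rfl fun i hi => sum_congr rfl fun j hj => by
      rw [h.interior_add_succ_right (by simp at hi; omega) (by simp at hj; omega)]] at hs
  rw [hs]
  have hc := h.two_mul_card_boxesOf ⟨(0, 0), by
    simp only [boxesOf, mem_filter, mem_product, mem_range]
    exact ⟨⟨hM, hN⟩, h.interior_corner (Or.inl rfl) (Or.inl rfl)⟩⟩
  have hc' : ((M + 1) * (N + 1) - 2) / 2 = #(boxesOf M N ch 1) := by omega
  rw [hc', card_boxesOf]
  push_cast
  simp only [sum_mul, ← sum_add_distrib]
  refine sum_congr rfl fun i hi => sum_congr rfl fun j hj => ?_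
  simp only [mem_range] at hi hj
  -- At a corner the indicator is one. Elsewhere the box has value `s`, so the correction term is
  -- zero.
  by_cases hcor : (i = 0 ∨ i + 1 = M) ∧ (j = 0 ∨ j + 1 = N)
  · rw [h.interior_corner hcor.1 hcor.2]; simp
  · rw [ht i j hi hj hcor]
    rcases zmod_two_eq_zero_or_one (interior ch (i + 1) (j + 1)) with hb | hb <;> simp [hb]

end IsSpanningCircle

variable {M N : ℕ}

/-! ### Coordinates on the grid -/

variable (M N) in
/-- The vertex `(i, j)` of the grid. -/
def vtx (i j : ℕ) : Fin (M + 1) × Fin (N + 1) := (Fin.ofNat (M + 1) i, Fin.ofNat (N + 1) j)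

/-- `vtx` wraps around modulo the size, which allows plain natural indices but makes explicit bounds
necessary here and in `hInd` and `vInd`. -/
theorem vtx_eq_mk {i j : ℕ} (hi : i < M + 1) (hj : j < N + 1) :
    vtx M N i j = (⟨i, hi⟩, ⟨j, hj⟩) := by
  simp [vtx, Prod.ext_iff, Fin.ext_iff, Nat.mod_eq_of_lt hi, Nat.mod_eq_of_lt hj]

theorem vtx_val (v : Fin (M + 1) × Fin (N + 1)) : vtx M N v.1 v.2 = v :=
  vtx_eq_mk v.1.2 v.2.2

theorem vtx_inj {i j k l : ℕ} (hi : i ≤ M) (hj : j ≤ N) (hk : k ≤ M) (hl : l ≤ N) :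
    vtx M N i j = vtx M N k l ↔ i = k ∧ j = l := by
  rw [vtx_eq_mk (by omega) (by omega), vtx_eq_mk (by omega) (by omega)]
  simp

variable (M N) in
/-- The edge joining `(i, j)` and `(i, j + 1)`. -/
def hE (i j : ℕ) : Sym2 (Fin (M + 1) × Fin (N + 1)) := s(vtx M N i j, vtx M N i (j + 1))

variable (M N) in
/-- The edge joining `(i, j)` and `(i + 1, j)`. -/
def vE (i j : ℕ) : Sym2 (Fin (M + 1) × Fin (N + 1)) := s(vtx M N i j, vtx M N (i + 1) j)

theorem adj_right {i j : ℕ} (hi : i ≤ M) (hj : j < N) :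
    (grid (M + 1) (N + 1)).Adj (vtx M N i j) (vtx M N i (j + 1)) := by
  rw [vtx_eq_mk (by omega) (by omega), vtx_eq_mk (by omega) (by omega)]
  simp [boxProd_adj, pathGraph_adj]

theorem adj_down {i j : ℕ} (hi : i < M) (hj : j ≤ N) :
    (grid (M + 1) (N + 1)).Adj (vtx M N i j) (vtx M N (i + 1) j) := by
  rw [vtx_eq_mk (by omega) (by omega), vtx_eq_mk (by omega) (by omega)]
  simp [boxProd_adj, pathGraph_adj]

theorem eq_of_adj_vtx {i j : ℕ} (hi : i ≤ M) (hj : j ≤ N) {w : Fin (M + 1) × Fin (N + 1)}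
    (h : (grid (M + 1) (N + 1)).Adj (vtx M N i j) w) :
    (j < N ∧ w = vtx M N i (j + 1)) ∨ (0 < j ∧ w = vtx M N i (j - 1)) ∨
      (i < M ∧ w = vtx M N (i + 1) j) ∨ (0 < i ∧ w = vtx M N (i - 1) j) := by
  obtain ⟨⟨k, hk⟩, ⟨l, hl⟩⟩ := w
  rw [vtx_eq_mk (by omega) (by omega)] at h
  simp only [boxProd_adj, pathGraph_adj, Fin.mk.injEq] at h
  rw [← vtx_eq_mk hk hl]
  rcases h with ⟨h | h, h'⟩ | ⟨h | h, h'⟩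
  · subst h h'; right; right; left; exact ⟨by omega, rfl⟩
  · subst h h'; right; right; right; exact ⟨by omega, rfl⟩
  · subst h h'; left; exact ⟨by omega, rfl⟩
  · subst h h'; right; left; exact ⟨by omega, rfl⟩

theorem hE_inj {i j k l : ℕ} (hi : i ≤ M) (hj : j < N) (hk : k ≤ M) (hl : l < N) :
    hE M N i j = hE M N k l ↔ i = k ∧ j = l := by
  simp only [hE, Sym2.eq_iff]
  rw [vtx_inj, vtx_inj, vtx_inj, vtx_inj] <;> omega

theorem vE_inj {i j k l : ℕ} (hi : i < M) (hj : j ≤ N) (hk : k < M) (hl : l ≤ N) :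
    vE M N i j = vE M N k l ↔ i = k ∧ j = l := by
  simp only [vE, Sym2.eq_iff]
  rw [vtx_inj, vtx_inj, vtx_inj, vtx_inj] <;> omega

theorem hE_ne_vE {i j k l : ℕ} (hi : i ≤ M) (hj : j < N) (hk : k < M) (hl : l ≤ N) :
    hE M N i j ≠ vE M N k l := by
  simp only [hE, vE, Ne, Sym2.eq_iff]
  rw [vtx_inj, vtx_inj, vtx_inj, vtx_inj] <;> omega

theorem edge_cases {e : Sym2 (Fin (M + 1) × Fin (N + 1))}
    (he : e ∈ (grid (M + 1) (N + 1)).edgeSet) :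
    (∃ i j, i ≤ M ∧ j < N ∧ e = hE M N i j) ∨ (∃ i j, i < M ∧ j ≤ N ∧ e = vE M N i j) := by
  induction e with
  | _ v w =>
    rw [mem_edgeSet] at he
    obtain ⟨⟨i, hi⟩, ⟨j, hj⟩⟩ := v
    rw [← vtx_eq_mk hi hj] at he ⊢
    rcases eq_of_adj_vtx (by omega) (by omega) he with ⟨h, rfl⟩ | ⟨h, rfl⟩ | ⟨h, rfl⟩ | ⟨h, rfl⟩
    · exact Or.inl ⟨i, j, by omega, h, rfl⟩
    · obtain ⟨j, rfl⟩ := Nat.exists_eq_add_of_lt h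
      exact Or.inl ⟨i, j, by omega, by omega, by rw [hE, Sym2.eq_swap]; simp⟩
    · exact Or.inr ⟨i, j, h, by omega, rfl⟩
    · obtain ⟨i, rfl⟩ := Nat.exists_eq_add_of_lt h
      exact Or.inr ⟨i, j, by omega, by omega, by rw [vE, Sym2.eq_swap]; simp⟩

/-! ### Signs -/

/-- A signature, extended by `1` to all pairs of vertices. -/
noncomputable def edgeSign {V : Type*} {G : SimpleGraph V} (σ : Signature G) (e : Sym2 V) : ℤˣ :=
  open Classical in if h : e ∈ G.edgeSet then σ ⟨e, h⟩ else 1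

theorem walkSign_eq {V : Type*} {G : SimpleGraph V} (σ : Signature G) {u v : V}
    (p : G.Walk u v) : walkSign σ p = (p.edges.map (edgeSign σ)).prod := by
  rw [walkSign]
  conv_rhs => rw [← List.attach_map_subtype_val p.edges, List.map_map]
  congr 1
  refine List.map_congr_left fun e _ => ?_
  simp [edgeSign, p.edges_subset_edgeSet e.2]

/-- The sign of the box with least vertex `x`. -/
noncomputable def boxVal (σ : Signature (grid (M + 1) (N + 1))) (x : ℕ × ℕ) : ℤˣ :=
  edgeSign σ (hE M N x.1 x.2) * edgeSign σ (hE M N (x.1 + 1) x.2) *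
    (edgeSign σ (vE M N x.1 x.2) * edgeSign σ (vE M N x.1 (x.2 + 1)))

theorem edgeSign_hE (σ : Signature (grid (M + 1) (N + 1))) {i j : ℕ} (hi : i < M + 1)
    (hj : j + 1 < N + 1) : edgeSign σ (hE M N i j) = σ (hEdge i j hi hj) := by
  have h : hE M N i j = (hEdge i j hi hj : (grid (M + 1) (N + 1)).edgeSet).1 := by
    rw [hE, vtx_eq_mk hi hj, vtx_eq_mk hi (Nat.lt_of_succ_lt hj)]; rfl
  rw [h, edgeSign, dif_pos (hEdge i j hi hj).2]

theorem edgeSign_vE (σ : Signature (grid (M + 1) (N + 1))) {i j : ℕ} (hi : i + 1 < M + 1)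
    (hj : j < N + 1) : edgeSign σ (vE M N i j) = σ (vEdge i j hi hj) := by
  have h : vE M N i j = (vEdge i j hi hj : (grid (M + 1) (N + 1)).edgeSet).1 := by
    rw [vE, vtx_eq_mk hi hj, vtx_eq_mk (Nat.lt_of_succ_lt hi) hj]; rfl
  rw [h, edgeSign, dif_pos (vEdge i j hi hj).2]

theorem boxSign_eq (σ : Signature (grid (M + 1) (N + 1))) (b : Box (M + 1) (N + 1)) :
    boxSign σ b = boxVal σ (b.1, b.2) := by
  have hi : b.1.val + 1 < M + 1 := Nat.add_lt_of_lt_sub b.1.isLt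
  have hj : b.2.val + 1 < N + 1 := Nat.add_lt_of_lt_sub b.2.isLt
  rw [boxVal, edgeSign_hE σ (by omega) hj, edgeSign_hE σ hi hj, edgeSign_vE σ hi (by omega),
    edgeSign_vE σ hi hj]
  rfl

/-- The exponent of a sign. -/
def signLog (u : ℤˣ) : ZMod 2 := if u = 1 then 0 else 1

theorem signLog_mul (u v : ℤˣ) : signLog (u * v) = signLog u + signLog v := by
  revert u v; decide

theorem signLog_injective : Function.Injective signLog := by
  intro u v; revert u v; decide

theorem signLog_list_prod (l : List ℤˣ) : signLog l.prod = (l.map signLog).sum := by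
  induction l with
  | nil => rfl
  | cons a l ih => simp [signLog_mul, ih]

/-! ### Hamiltonian circles as spanning circles -/

section

variable {u : Fin (M + 1) × Fin (N + 1)} (p : (grid (M + 1) (N + 1)).Walk u u)

/-- The indicator of the horizontal edges of a closed walk. -/
def hInd (i : ℕ) : ℕ → ℕ
  | 0 => 0
  | j + 1 => if i ≤ M ∧ j < N ∧ hE M N i j ∈ p.edges then 1 else 0

/-- The indicator of the vertical edges of a closed walk. -/
def vInd : ℕ → ℕ → ℕ
  | 0, _ => 0
  | i + 1, j => if i < M ∧ j ≤ N ∧ vE M N i j ∈ p.edges then 1 else 0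

/-- This and the three similar lemmas write each indicator as the size of a piece of the neighbor
set of `(i, j)` in the walk, in preparation for `degree_eq_two`. -/
theorem hInd_eq (i j : ℕ) : hInd p i j =
    #(if 0 < j ∧ i ≤ M ∧ j ≤ N ∧ s(vtx M N i j, vtx M N i (j - 1)) ∈ p.edges then
      {vtx M N i (j - 1)} else ∅) := by
  cases j with
  | zero => simp [hInd]
  | succ j =>
    simp only [hInd, hE, Sym2.eq_swap (a := vtx M N i j), Nat.add_sub_cancel, Nat.succ_pos,
      true_and, Nat.succ_le_iff]
    split_ifs <;> rfl

theorem hInd_succ_eq (i j : ℕ) : hInd p i (j + 1) =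
    #(if i ≤ M ∧ j < N ∧ s(vtx M N i j, vtx M N i (j + 1)) ∈ p.edges then
      {vtx M N i (j + 1)} else ∅) := by
  simp only [hInd, hE]
  rw [apply_ite card, card_singleton, card_empty]
  congr

theorem vInd_eq (i j : ℕ) : vInd p i j =
    #(if 0 < i ∧ i ≤ M ∧ j ≤ N ∧ s(vtx M N i j, vtx M N (i - 1) j) ∈ p.edges then
      {vtx M N (i - 1) j} else ∅) := by
  cases i with
  | zero => simp [vInd]
  | succ i =>
    simp only [vInd, vE, Sym2.eq_swap (a := vtx M N i j), Nat.add_sub_cancel, Nat.succ_pos,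
      true_and, Nat.succ_le_iff]
    split_ifs <;> rfl

theorem vInd_succ_eq (i j : ℕ) : vInd p (i + 1) j =
    #(if i < M ∧ j ≤ N ∧ s(vtx M N i j, vtx M N (i + 1) j) ∈ p.edges then
      {vtx M N (i + 1) j} else ∅) := by
  simp only [vInd, vE]
  rw [apply_ite card, card_singleton, card_empty]
  congr

theorem disjoint_ite {V : Type*} [DecidableEq V] {P Q : Prop} [Decidable P] [Decidable Q]
    {a b : V} (h : P → Q → a ≠ b) :
    Disjoint (if P then {a} else ∅ : Finset V) (if Q then {b} else ∅) := by
  split_ifs <;> simp_all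

/-- The four pieces are disjoint and make up the neighbor set in the subgraph of the cycle, which
has two elements. -/
theorem degree_eq_two (hp : p.IsHamiltonianCycle) {i j : ℕ} (hi : i ≤ M) (hj : j ≤ N) :
    hInd p i j + hInd p i (j + 1) + vInd p i j + vInd p (i + 1) j = 2 := by
  rw [hInd_eq, hInd_succ_eq, vInd_eq, vInd_succ_eq, ← card_union_of_disjoint,
    ← card_union_of_disjoint, ← card_union_of_disjoint, ← Set.ncard_coe_finset,
    ← hp.isCycle.ncard_neighborSet_toSubgraph_eq_two (hp.mem_support (vtx M N i j))]
  · congr 1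
    ext w
    simp only [coe_union, Set.mem_union, mem_coe, Subgraph.mem_neighborSet,
      Walk.adj_toSubgraph_iff_mem_edges]
    constructor
    · rintro (((h | h) | h) | h) <;> split_ifs at h with hc <;> simp at h <;> subst h <;> tauto
    · intro h
      rcases eq_of_adj_vtx hi hj (p.adj_of_mem_edges h) with
        ⟨h', rfl⟩ | ⟨h', rfl⟩ | ⟨h', rfl⟩ | ⟨h', rfl⟩
      · left; left; right; simp [hi, h', h]
      · left; left; left; simp [hi, hj, h', h]
      · right; simp [hj, h', h]
      · left; right; simp [hi, hj, h', h]
  · simp only [disjoint_union_left]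
    refine ⟨⟨disjoint_ite ?_, disjoint_ite ?_⟩, disjoint_ite ?_⟩
    all_goals intro h1 h2; rw [Ne, vtx_inj] <;> omega
  · simp only [disjoint_union_left]
    refine ⟨disjoint_ite ?_, disjoint_ite ?_⟩
    all_goals intro h1 h2; rw [Ne, vtx_inj] <;> omega
  · refine disjoint_ite ?_
    intro h1 h2; rw [Ne, vtx_inj] <;> omega

theorem eq_of_walk {V α : Type*} {G : SimpleGraph V} (T : V → α) {u v : V} (q : G.Walk u v)
    (h : ∀ a b, s(a, b) ∈ q.edges → T a = T b) : T u = T v := by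
  induction q with
  | nil => rfl
  | cons hadj q ih =>
    rw [h _ _ (List.mem_cons_self ..), ih fun a b hab => h a b (List.mem_cons_of_mem _ hab)]

theorem isSpanningCircle (hp : p.IsHamiltonianCycle) :
    IsSpanningCircle M N (hInd p) (vInd p) where
  ch_le i j := by cases j <;> simp only [hInd] <;> (try split_ifs) <;> simp
  cv_le i j := by cases i <;> simp only [vInd] <;> (try split_ifs) <;> simp
  left _ := rfl
  right _ := by simp [hInd]
  top _ := rfl
  bot _ := by simp [vInd]
  deg _ _ := degree_eq_two p hp
  conn S hSh hSv := by
    set T : Fin (M + 1) × Fin (N + 1) → ZMod 2 := fun v => S v.1 v.2 with hT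
    have hTv : ∀ i j, i ≤ M → j ≤ N → T (vtx M N i j) = S i j := fun i j hi hj => by
      rw [vtx_eq_mk (by omega) (by omega)]
    have hedge : ∀ a b, s(a, b) ∈ p.edges → T a = T b := by
      intro a b hab
      rcases edge_cases (p.edges_subset_edgeSet hab) with ⟨i, j, hi, hj, he⟩ | ⟨i, j, hi, hj, he⟩
      · have := hSh i j hi hj (by simp [hInd, hi, hj, ← he, hab])
        rw [← hTv i j hi hj.le, ← hTv i (j + 1) hi hj] at this
        rw [hE, Sym2.eq_iff] at he
        rcases he with ⟨rfl, rfl⟩ | ⟨rfl, rfl⟩ <;> simp [this]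
      · have := hSv i j hi hj (by simp [vInd, hi, hj, ← he, hab])
        rw [← hTv i j hi.le hj, ← hTv (i + 1) j hi hj] at this
        rw [vE, Sym2.eq_iff] at he
        rcases he with ⟨rfl, rfl⟩ | ⟨rfl, rfl⟩ <;> simp [this]
    -- Every vertex is reached from the base point along the circle itself.
    have hall : ∀ v, T u = T v := fun v =>
      eq_of_walk T (p.takeUntil v (hp.mem_support v))
        fun a b hab => hedge a b (p.edges_takeUntil_subset_edges _ hab)
    intro i j hi hj
    rw [← hTv i j hi hj, ← hTv 0 0 (by omega) (by omega)]
    exact (hall _).symm.trans (hall _)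

/-- A cycle repeats no edge, so the sum along it is a sum over a set of edges, which splits into
horizontal and vertical ones. -/
theorem sum_edges_map (hp : p.IsHamiltonianCycle)
    (g : Sym2 (Fin (M + 1) × Fin (N + 1)) → ZMod 2) :
    (p.edges.map g).sum =
      ∑ i ∈ range (M + 1), ∑ j ∈ range N, hInd p i (j + 1) * g (hE M N i j) +
      ∑ i ∈ range M, ∑ j ∈ range (N + 1), vInd p (i + 1) j * g (vE M N i j) := by
  rw [← List.sum_toFinset _ hp.isCycle.edges_nodup]
  have h1 : ∑ i ∈ range (M + 1), ∑ j ∈ range N, hInd p i (j + 1) * g (hE M N i j) =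
      ∑ e ∈ image (fun x : ℕ × ℕ => hE M N x.1 x.2)
        {x ∈ range (M + 1) ×ˢ range N | hE M N x.1 x.2 ∈ p.edges}, g e := by
    rw [sum_image, sum_filter, sum_product]
    · refine sum_congr rfl fun i hi => sum_congr rfl fun j hj => ?_
      simp only [mem_range, Nat.lt_succ_iff] at hi hj
      simp [hInd, hi, hj]
    · rintro ⟨i, j⟩ hx ⟨k, l⟩ hy hxy
      simp only [mem_coe, mem_filter, mem_product, mem_range, Nat.lt_succ_iff] at hx hy
      simpa using (hE_inj hx.1.1 hx.1.2 hy.1.1 hy.1.2).1 hxy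
  have h2 : ∑ i ∈ range M, ∑ j ∈ range (N + 1), vInd p (i + 1) j * g (vE M N i j) =
      ∑ e ∈ image (fun x : ℕ × ℕ => vE M N x.1 x.2)
        {x ∈ range M ×ˢ range (N + 1) | vE M N x.1 x.2 ∈ p.edges}, g e := by
    rw [sum_image, sum_filter, sum_product]
    · refine sum_congr rfl fun i hi => sum_congr rfl fun j hj => ?_
      simp only [mem_range, Nat.lt_succ_iff] at hi hj
      simp [vInd, hi, hj]
    · rintro ⟨i, j⟩ hx ⟨k, l⟩ hy hxy
      simp only [mem_coe, mem_filter, mem_product, mem_range, Nat.lt_succ_iff] at hx hy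
      simpa using (vE_inj hx.1.1 hx.1.2 hy.1.1 hy.1.2).1 hxy
  rw [h1, h2, ← sum_union]
  · congr 1
    ext e
    simp only [List.mem_toFinset, mem_union, mem_image, mem_filter, mem_product, mem_range,
      Nat.lt_succ_iff, Prod.exists]
    constructor
    · intro he
      rcases edge_cases (p.edges_subset_edgeSet he) with
        ⟨i, j, hi, hj, rfl⟩ | ⟨i, j, hi, hj, rfl⟩
      · exact Or.inl ⟨i, j, ⟨⟨hi, hj⟩, he⟩, rfl⟩
      · exact Or.inr ⟨i, j, ⟨⟨hi, hj⟩, he⟩, rfl⟩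
    · rintro (⟨i, j, ⟨_, he⟩, rfl⟩ | ⟨i, j, ⟨_, he⟩, rfl⟩) <;> exact he
  · rw [Finset.disjoint_left]
    simp only [mem_image, mem_filter, mem_product, mem_range, Nat.lt_succ_iff, Prod.exists]
    rintro e ⟨i, j, ⟨⟨hi, hj⟩, _⟩, rfl⟩ ⟨k, l, ⟨⟨hk, hl⟩, _⟩, he⟩
    exact hE_ne_vE hi hj hk hl he.symm

end

/-! ### Equal non-corner boxes give equal circles -/

theorem isCorner_iff (b : Box (M + 1) (N + 1)) : IsCorner b ↔
    (b.1.val = 0 ∨ b.1.val + 1 = M) ∧ (b.2.val = 0 ∨ b.2.val + 1 = N) := Iff.rfl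

/-- If all boxes except the corners have the same sign, so do all Hamiltonian circles. -/
theorem allHamiltonianSameSign_of_boxes (hM : 0 < M) (hN : 0 < N)
    (σ : Signature (grid (M + 1) (N + 1))) (s : ℤˣ)
    (h : ∀ b : Box (M + 1) (N + 1), ¬ IsCorner b → boxSign σ b = s) :
    AllHamiltonianSameSign σ := by
  intro u v p q hp hq
  apply signLog_injective
  have ht : ∀ i j, i < M → j < N → ¬ ((i = 0 ∨ i + 1 = M) ∧ (j = 0 ∨ j + 1 = N)) →
      signLog (edgeSign σ (hE M N i j)) + signLog (edgeSign σ (hE M N (i + 1) j)) +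
        (signLog (edgeSign σ (vE M N i j)) + signLog (edgeSign σ (vE M N i (j + 1)))) =
      signLog s := by
    intro i j hi hj hc
    rw [← h (⟨i, hi⟩, ⟨j, hj⟩) hc, boxSign_eq]
    simp only [boxVal, signLog_mul]
  rw [walkSign_eq, walkSign_eq, signLog_list_prod, signLog_list_prod, List.map_map, List.map_map,
    sum_edges_map p hp, sum_edges_map q hq]
  exact ((isSpanningCircle p hp).sum_edges_eq hM hN
    (fun i j => signLog (edgeSign σ (hE M N i j))) (fun i j => signLog (edgeSign σ (vE M N i j)))
    _ ht).trans ((isSpanningCircle q hq).sum_edges_eq hM hN _ _ _ ht).symm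

/-! ### Enlarging a cycle -/

/-- A cycle through the edge `xy`, with that edge removed, is a path from `y` to `x`. -/
theorem exists_path_of_mem_edges {V : Type*} {G : SimpleGraph V} {u x y : V}
    {p : G.Walk u u} (hp : p.IsCycle) (hxy : s(x, y) ∈ p.edges) :
    ∃ q : G.Walk y x, q.IsPath ∧ p.edges.Perm (s(x, y) :: q.edges) ∧
      ∀ v, v ∈ q.support ↔ v ∈ p.support := by
  have key : ∀ {x y : V} (h : G.Adj x y), (⟨(x, y), h⟩ : G.Dart) ∈ p.darts →
      ∃ q : G.Walk y x, q.IsPath ∧ p.edges.Perm (s(x, y) :: q.edges) ∧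
      ∀ v, v ∈ q.support ↔ v ∈ p.support := by
    intro x y h hd
    have hsplit : ∀ {a b : V} (p : G.Walk a b), (⟨(x, y), h⟩ : G.Dart) ∈ p.darts →
        ∃ (q₁ : G.Walk a x) (q₂ : G.Walk y b), p = q₁.append (Walk.cons h q₂) := by
      intro a b p hd
      induction p with
      | nil => simp at hd
      | cons hadj p ih =>
        rw [Walk.darts_cons, List.mem_cons] at hd
        rcases hd with hd | hd
        · injection hd with hd
          injection hd with h1 h2
          subst h1 h2
          exact ⟨Walk.nil, p, rfl⟩
        · obtain ⟨q₁, q₂, rfl⟩ := ih hd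
          exact ⟨Walk.cons hadj q₁, q₂, rfl⟩
    obtain ⟨q₁, q₂, rfl⟩ := hsplit p hd
    -- The path is the cycle restarted after the removed edge; its vertices are those of the cycle
    -- with the base point counted once.
    have hperm : (q₂.append q₁).support.Perm (q₁.append (Walk.cons h q₂)).support.tail := by
      rw [Walk.support_append, Walk.support_append, Walk.support_cons, List.tail_cons]
      rw [← Walk.cons_tail_support q₁, List.cons_append, List.tail_cons, List.tail_cons]
      exact List.perm_append_comm
    refine ⟨q₂.append q₁, ?_, ?_, fun v => ?_⟩
    · rw [Walk.isPath_def]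
      exact hperm.nodup_iff.2 hp.support_nodup
    · simp only [Walk.edges_append, Walk.edges_cons]
      exact List.perm_middle.trans (List.Perm.cons _ List.perm_append_comm)
    · simp only [Walk.mem_support_append_iff, Walk.support_cons, List.mem_cons]
      constructor
      · tauto
      · rintro (h | h | h)
        · exact Or.inr h
        · subst h; exact Or.inr q₁.end_mem_support
        · exact Or.inl h
  have hadj : G.Adj x y := p.adj_of_mem_edges hxy
  rw [Walk.edges, List.mem_map] at hxy
  obtain ⟨d, hd, he⟩ := hxy
  rcases dart_edge_eq_mk'_iff.1 he with h | h
  · exact key hadj (by rwa [show (⟨(x, y), hadj⟩ : G.Dart) = d from Dart.ext _ _ h.symm])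
  · obtain ⟨q, hq, hperm, hs⟩ := key hadj.symm
      (by rwa [show (⟨(y, x), hadj.symm⟩ : G.Dart) = d from Dart.ext _ _ h.symm])
    refine ⟨q.reverse, hq.reverse, ?_, by simpa using hs⟩
    rw [Walk.edges_reverse, Sym2.eq_swap]
    exact hperm.trans (List.Perm.cons _ (List.reverse_perm _).symm)

/-- Replacing the edge `xy` of a cycle by a path `x, a, b, y` through two new vertices. -/
theorem exists_cycle_detour {V : Type*} {G : SimpleGraph V} {u x y a b : V}
    {p : G.Walk u u} (hp : p.IsCycle) (hxy : s(x, y) ∈ p.edges) (ha : a ∉ p.support)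
    (hb : b ∉ p.support) (hxa : G.Adj x a) (hab : G.Adj a b) (hby : G.Adj b y) :
    ∃ q : G.Walk x x, q.IsCycle ∧ (∀ v, v ∈ q.support ↔ v = a ∨ v = b ∨ v ∈ p.support) ∧
      (∀ e ∈ p.edges, e ≠ s(x, y) → e ∈ q.edges) ∧
      s(x, a) ∈ q.edges ∧ s(a, b) ∈ q.edges ∧ s(b, y) ∈ q.edges ∧
      ∀ f : Sym2 V → ℤˣ, (q.edges.map f).prod = (p.edges.map f).prod *
        (f s(x, y) * f s(x, a) * f s(a, b) * f s(b, y)) := by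
  obtain ⟨q, hq, hperm, hs⟩ := exists_path_of_mem_edges hp hxy
  have hx : x ∈ p.support := p.fst_mem_support_of_mem_edges hxy
  have hy : y ∈ p.support := p.snd_mem_support_of_mem_edges hxy
  have ha' : a ∉ q.support := by rwa [hs]
  have hb' : b ∉ q.support := by rwa [hs]
  have hne : a ≠ y := by rintro rfl; exact ha hy
  have hne' : x ≠ b := by rintro rfl; exact hb hx
  refine ⟨Walk.cons hxa (Walk.cons hab (Walk.cons hby q)), ?_, fun v => ?_, ?_, by simp, by simp,
    by simp, fun f => ?_⟩
  · rw [Walk.cons_isCycle_iff]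
    constructor
    · rw [Walk.cons_isPath_iff, Walk.cons_isPath_iff]
      exact ⟨⟨hq, hb'⟩, by simpa [hab.ne] using ha'⟩
    · simp only [Walk.edges_cons, List.mem_cons, not_or]
      refine ⟨?_, ?_, fun h => ha' (q.snd_mem_support_of_mem_edges h)⟩
      · simp [hne', hxa.ne]
      · simp [hne', hne, hab.ne]
  · simp only [Walk.support_cons, List.mem_cons, hs]
    constructor
    · rintro (rfl | h | h | h) <;> tauto
    · tauto
  · intro e he hne
    have := (hperm.mem_iff).1 he
    simp only [List.mem_cons, hne, false_or] at this
    simp [this]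
  · rw [(hperm.map f).prod_eq]
    simp only [Walk.edges_cons, List.map_cons, List.prod_cons]
    -- Signs square to one, so deleting `xy` has the same effect as multiplying by its sign.
    have : f s(x, y) * f s(x, y) = 1 := Int.units_mul_self _
    calc _ = (f s(x, y) * f s(x, y)) * (f s(x, a) * (f s(a, b) * (f s(b, y) *
        (q.edges.map f).prod))) := by rw [this, one_mul]
      _ = _ := by
        simp only [mul_assoc, mul_comm, mul_left_comm]

/-! ### Polyominoes without interior vertices -/

/-- The vertex `(a, b)` is on no box of `B`. -/
def IsFree (B : Finset (ℕ × ℕ)) (a b : ℕ) : Prop :=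
  ∀ x ∈ B, ¬ ((a = x.1 ∨ a = x.1 + 1) ∧ (b = x.2 ∨ b = x.2 + 1))

/-- Sets of boxes built up from one box by adding boxes across an edge, in such a way that the
other two vertices of the new box are not on any former box. -/
inductive Grown : Finset (ℕ × ℕ) → Prop
  | single (x : ℕ × ℕ) : Grown {x}
  | right {B i j} : Grown B → (i, j) ∈ B → IsFree B i (j + 2) → IsFree B (i + 1) (j + 2) →
      Grown (insert (i, j + 1) B)
  | left {B i j} : Grown B → (i, j + 1) ∈ B → IsFree B i j → IsFree B (i + 1) j →
      Grown (insert (i, j) B)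
  | down {B i j} : Grown B → (i, j) ∈ B → IsFree B (i + 2) j → IsFree B (i + 2) (j + 1) →
      Grown (insert (i + 1, j) B)
  | up {B i j} : Grown B → (i + 1, j) ∈ B → IsFree B i j → IsFree B i (j + 1) →
      Grown (insert (i, j) B)

variable {M N : ℕ}

/-- The closed walk `p` runs around the set `B` of boxes. -/
structure IsBoundary (σ : Signature (grid (M + 1) (N + 1))) (B : Finset (ℕ × ℕ))
    {u : Fin (M + 1) × Fin (N + 1)} (p : (grid (M + 1) (N + 1)).Walk u u) : Prop where
  cycle : p.IsCycle
  support : ∀ i j, i ≤ M → j ≤ N → (vtx M N i j ∈ p.support ↔ ¬ IsFree B i j)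
  right : ∀ i j, (i, j) ∈ B → (i, j + 1) ∉ B → vE M N i (j + 1) ∈ p.edges
  left : ∀ i j, (i, j + 1) ∈ B → (i, j) ∉ B → vE M N i (j + 1) ∈ p.edges
  down : ∀ i j, (i, j) ∈ B → (i + 1, j) ∉ B → hE M N (i + 1) j ∈ p.edges
  up : ∀ i j, (i + 1, j) ∈ B → (i, j) ∉ B → hE M N (i + 1) j ∈ p.edges
  sign : walkSign σ p = ∏ x ∈ B, boxVal σ x

theorem isFree_insert {B : Finset (ℕ × ℕ)} {x : ℕ × ℕ} {a b : ℕ} : IsFree (insert x B) a b ↔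
    ¬ ((a = x.1 ∨ a = x.1 + 1) ∧ (b = x.2 ∨ b = x.2 + 1)) ∧ IsFree B a b := by
  simp [IsFree]

theorem isFree_singleton {x : ℕ × ℕ} {a b : ℕ} : IsFree {x} a b ↔
    ¬ ((a = x.1 ∨ a = x.1 + 1) ∧ (b = x.2 ∨ b = x.2 + 1)) := by
  simp [IsFree]

theorem exists_boundary_single (σ : Signature (grid (M + 1) (N + 1))) {i j : ℕ} (hi : i < M)
    (hj : j < N) : ∃ (u : _) (p : (grid (M + 1) (N + 1)).Walk u u), IsBoundary σ {(i, j)} p := by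
  have h1 := adj_right hi.le hj
  have h2 := adj_down (M := M) (N := N) hi (j := j + 1) hj
  have h3 := (adj_right (M := M) (N := N) (i := i + 1) hi hj).symm
  have h4 := (adj_down hi hj.le).symm
  have n1 : vtx M N i j ≠ vtx M N (i + 1) (j + 1) := by rw [Ne, vtx_inj] <;> omega
  have n2 : vtx M N i (j + 1) ≠ vtx M N (i + 1) j := by rw [Ne, vtx_inj] <;> omega
  refine ⟨_, .cons h1 (.cons h2 (.cons h3 (.cons h4 .nil))), ?_, ?_, ?_, ?_, ?_, ?_, ?_⟩
  · rw [Walk.cons_isCycle_iff]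
    simp [Walk.cons_isPath_iff, h1.ne, h1.ne', h2.ne, h3.ne, h4.ne, h4.ne', n1,
      n1.symm, n2]
  · intro k l hk hl
    simp only [Walk.support_cons, Walk.support_nil, List.mem_cons, List.not_mem_nil, or_false,
      isFree_singleton]
    rw [vtx_inj, vtx_inj, vtx_inj, vtx_inj] <;> omega
  · intro k l hk _
    obtain ⟨rfl, rfl⟩ : k = i ∧ l = j := by simpa using hk
    simp [vE]
  · intro k l hk _
    obtain ⟨rfl, rfl⟩ : k = i ∧ l + 1 = j := by simpa using hk
    simp [vE]
  · intro k l hk _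
    obtain ⟨rfl, rfl⟩ : k = i ∧ l = j := by simpa using hk
    simp [hE]
  · intro k l hk _
    obtain ⟨rfl, rfl⟩ : k + 1 = i ∧ l = j := by simpa using hk
    simp [hE]
  · rw [walkSign_eq, prod_singleton]
    simp only [Walk.edges_cons, Walk.edges_nil, List.map_cons, List.map_nil, List.prod_cons,
      List.prod_nil, boxVal, hE, vE, mul_one]
    rw [Sym2.eq_swap (a := vtx M N (i + 1) (j + 1)),
      Sym2.eq_swap (a := vtx M N (i + 1) j) (b := vtx M N i j)]
    simp only [mul_assoc, mul_comm, mul_left_comm]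

/-- The step common to all four directions: the new box has corners `x, a, b, y` in cyclic order,
`xy` is the side shared with the old set, and the cycle is rerouted through `a, b`. `hsepH` and
`hsepV` say that `xy` now has the new set on both sides, so it is the only edge that may leave the
boundary. -/
theorem IsBoundary.attach {σ : Signature (grid (M + 1) (N + 1))} {B : Finset (ℕ × ℕ)}
    {u : Fin (M + 1) × Fin (N + 1)} {p : (grid (M + 1) (N + 1)).Walk u u}
    (h : IsBoundary σ B p) (hB : ∀ x ∈ B, x.1 < M ∧ x.2 < N) {k l : ℕ} (hk : k < M) (hl : l < N)
    {x y a b : ℕ × ℕ}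
    (hbox : ∀ i j, ((i = k ∨ i = k + 1) ∧ (j = l ∨ j = l + 1)) ↔
      (i, j) = x ∨ (i, j) = a ∨ (i, j) = b ∨ (i, j) = y)
    (hx : ¬ IsFree B x.1 x.2) (hy : ¬ IsFree B y.1 y.2)
    (ha : IsFree B a.1 a.2) (hb : IsFree B b.1 b.2)
    (hxy : s(vtx M N x.1 x.2, vtx M N y.1 y.2) ∈ p.edges)
    (hxa : (grid (M + 1) (N + 1)).Adj (vtx M N x.1 x.2) (vtx M N a.1 a.2))
    (hab : (grid (M + 1) (N + 1)).Adj (vtx M N a.1 a.2) (vtx M N b.1 b.2))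
    (hby : (grid (M + 1) (N + 1)).Adj (vtx M N b.1 b.2) (vtx M N y.1 y.2))
    (hedge : ∀ e, (e = hE M N k l ∨ e = hE M N (k + 1) l ∨ e = vE M N k l ∨
      e = vE M N k (l + 1)) → e = s(vtx M N x.1 x.2, vtx M N y.1 y.2) ∨
      e = s(vtx M N x.1 x.2, vtx M N a.1 a.2) ∨ e = s(vtx M N a.1 a.2, vtx M N b.1 b.2) ∨
      e = s(vtx M N b.1 b.2, vtx M N y.1 y.2))
    (hsepH : ∀ i j, i < M → j < N → hE M N (i + 1) j = s(vtx M N x.1 x.2, vtx M N y.1 y.2) →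
      (i, j) ∈ insert (k, l) B ∧ (i + 1, j) ∈ insert (k, l) B)
    (hsepV : ∀ i j, i < M → j < N → vE M N i (j + 1) = s(vtx M N x.1 x.2, vtx M N y.1 y.2) →
      (i, j) ∈ insert (k, l) B ∧ (i, j + 1) ∈ insert (k, l) B)
    (hsign : edgeSign σ s(vtx M N x.1 x.2, vtx M N y.1 y.2) *
      edgeSign σ s(vtx M N x.1 x.2, vtx M N a.1 a.2) *
      edgeSign σ s(vtx M N a.1 a.2, vtx M N b.1 b.2) *
      edgeSign σ s(vtx M N b.1 b.2, vtx M N y.1 y.2) = boxVal σ (k, l)) :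
    ∃ (u : _) (q : (grid (M + 1) (N + 1)).Walk u u), IsBoundary σ (insert (k, l) B) q := by
  have ra := (hbox a.1 a.2).2 (Or.inr (Or.inl rfl))
  have rb := (hbox b.1 b.2).2 (Or.inr (Or.inr (Or.inl rfl)))
  have hz : (k, l) ∉ B := fun hz => ha _ hz ra
  have hB' : ∀ x ∈ insert (k, l) B, x.1 < M ∧ x.2 < N := by
    simp only [mem_insert, forall_eq_or_imp]
    exact ⟨⟨hk, hl⟩, hB⟩
  obtain ⟨q, hq, hs, hold, h1, h2, h3, hprod⟩ := exists_cycle_detour h.cycle hxy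
    (by rwa [h.support _ _ (by omega) (by omega), not_not])
    (by rwa [h.support _ _ (by omega) (by omega), not_not]) hxa hab hby
  -- The other three sides of the new box are on the new cycle.
  have hnew : ∀ e, (e = hE M N k l ∨ e = hE M N (k + 1) l ∨ e = vE M N k l ∨
      e = vE M N k (l + 1)) → e ≠ s(vtx M N x.1 x.2, vtx M N y.1 y.2) → e ∈ q.edges := by
    intro e he hne
    rcases hedge e he with rfl | rfl | rfl | rfl
    · exact absurd rfl hne
    all_goals assumption
  refine ⟨_, q, hq, ?_, ?_, ?_, ?_, ?_, ?_⟩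
  · intro i j hi hj
    rw [hs, isFree_insert, hbox, vtx_inj hi hj (by omega) (by omega),
      vtx_inj hi hj (by omega) (by omega), h.support i j hi hj]
    have hx' : (i, j) = x → ¬ IsFree B i j := by rintro rfl; exact hx
    have hy' : (i, j) = y → ¬ IsFree B i j := by rintro rfl; exact hy
    simp only [← Prod.mk_inj, Prod.mk.eta]
    by_cases hf : IsFree B i j
    · have n1 : (i, j) ≠ x := fun e => hx' e hf
      have n2 : (i, j) ≠ y := fun e => hy' e hf
      simpa [hf, n1, n2] using or_iff_not_imp_left
    · simp [hf]
  · intro i j hi hj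
    have hne : vE M N i (j + 1) ≠ _ := fun he => hj (hsepV i j (hB' _ hi).1 (hB' _ hi).2 he).2
    simp only [mem_insert, not_or] at hi hj
    rcases hi with hi | hi
    · rw [Prod.mk_inj] at hi
      exact hnew _ (by simp [hi]) hne
    · exact hold _ (h.right i j hi hj.2) hne
  · intro i j hi hj
    have hne : vE M N i (j + 1) ≠ _ := fun he =>
      hj (hsepV i j (hB' _ hi).1 (Nat.lt_of_succ_lt (hB' _ hi).2) he).1
    simp only [mem_insert, not_or] at hi hj
    rcases hi with hi | hi
    · rw [Prod.mk_inj] at hi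
      exact hnew _ (by simp [hi]) hne
    · exact hold _ (h.left i j hi hj.2) hne
  · intro i j hi hj
    have hne : hE M N (i + 1) j ≠ _ := fun he => hj (hsepH i j (hB' _ hi).1 (hB' _ hi).2 he).2
    simp only [mem_insert, not_or] at hi hj
    rcases hi with hi | hi
    · rw [Prod.mk_inj] at hi
      exact hnew _ (by simp [hi]) hne
    · exact hold _ (h.down i j hi hj.2) hne
  · intro i j hi hj
    have hne : hE M N (i + 1) j ≠ _ := fun he =>
      hj (hsepH i j (Nat.lt_of_succ_lt (hB' _ hi).1) (hB' _ hi).2 he).1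
    simp only [mem_insert, not_or] at hi hj
    rcases hi with hi | hi
    · rw [Prod.mk_inj] at hi
      exact hnew _ (by simp [hi]) hne
    · exact hold _ (h.up i j hi hj.2) hne
  · rw [walkSign_eq, hprod, ← walkSign_eq, h.sign, hsign, prod_insert hz, mul_comm]

theorem not_isFree {B : Finset (ℕ × ℕ)} {i j a b : ℕ} (h : (i, j) ∈ B)
    (hab : (a = i ∨ a = i + 1) ∧ (b = j ∨ b = j + 1)) : ¬ IsFree B a b :=
  fun hf => hf _ h hab

theorem Grown.exists_boundary (σ : Signature (grid (M + 1) (N + 1))) {B : Finset (ℕ × ℕ)}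
    (h : Grown B) (hB : ∀ x ∈ B, x.1 < M ∧ x.2 < N) :
    ∃ (u : _) (p : (grid (M + 1) (N + 1)).Walk u u), IsBoundary σ B p := by
  induction h with
  | single x => exact exists_boundary_single σ (hB x (by simp)).1 (hB x (by simp)).2
  | @right B i j _ hij ha hb ih =>
    simp only [mem_insert, forall_eq_or_imp] at hB
    obtain ⟨⟨hi, hj⟩, hB⟩ := hB
    obtain ⟨u, p, hp⟩ := ih hB
    have hn : (i, j + 1) ∉ B := fun hn => ha _ hn (by simp)
    refine hp.attach hB hi hj (x := (i, j + 1)) (y := (i + 1, j + 1)) (a := (i, j + 2))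
      (b := (i + 1, j + 2)) ?_ (not_isFree hij (by simp)) (not_isFree hij (by simp)) ha hb
      (hp.right i j hij hn) (adj_right hi.le hj) (adj_down hi hj) (adj_right hi hj).symm ?_ ?_ ?_ ?_
    · intro k l; simp only [Prod.mk.injEq]; omega
    · simp only [hE, vE, Sym2.eq_swap (a := vtx M N (i + 1) (j + 2))]; tauto
    · intro k l hk hl he
      exact absurd he (hE_ne_vE hk hl hi hj.le)
    · intro k l hk hl he
      obtain ⟨rfl, h'⟩ := (vE_inj hk hl hi hj.le).1 he
      obtain rfl : l = j := by omega
      simp [hij]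
    · simp only [boxVal, hE, vE, Sym2.eq_swap (a := vtx M N (i + 1) (j + 2))]
      exact (by intros; ac_rfl : ∀ a b c d : ℤˣ, a * b * c * d = b * d * (a * c)) _ _ _ _
  | @left B i j _ hij ha hb ih =>
    simp only [mem_insert, forall_eq_or_imp] at hB
    obtain ⟨⟨hi, hj⟩, hB⟩ := hB
    obtain ⟨u, p, hp⟩ := ih hB
    have hn : (i, j) ∉ B := fun hn => ha _ hn (by simp)
    refine hp.attach hB hi hj (x := (i, j + 1)) (y := (i + 1, j + 1)) (a := (i, j))
      (b := (i + 1, j)) ?_ (not_isFree hij (by simp)) (not_isFree hij (by simp)) ha hb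
      (hp.left i j hij hn) (adj_right hi.le hj).symm (adj_down hi hj.le) (adj_right hi hj)
      ?_ ?_ ?_ ?_
    · intro k l; simp only [Prod.mk.injEq]; omega
    · simp only [hE, vE, Sym2.eq_swap (a := vtx M N i (j + 1)) (b := vtx M N i j)]; tauto
    · intro k l hk hl he
      exact absurd he (hE_ne_vE hk hl hi hj)
    · intro k l hk hl he
      obtain ⟨rfl, h'⟩ := (vE_inj hk hl hi hj).1 he
      obtain rfl : l = j := by omega
      simp [hij]
    · simp only [boxVal, hE, vE, Sym2.eq_swap (a := vtx M N i (j + 1)) (b := vtx M N i j)]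
      exact (by intros; ac_rfl : ∀ a b c d : ℤˣ, a * b * c * d = b * d * (c * a)) _ _ _ _
  | @down B i j _ hij ha hb ih =>
    simp only [mem_insert, forall_eq_or_imp] at hB
    obtain ⟨⟨hi, hj⟩, hB⟩ := hB
    obtain ⟨u, p, hp⟩ := ih hB
    have hn : (i + 1, j) ∉ B := fun hn => ha _ hn (by simp)
    refine hp.attach hB hi hj (x := (i + 1, j)) (y := (i + 1, j + 1)) (a := (i + 2, j))
      (b := (i + 2, j + 1)) ?_ (not_isFree hij (by simp)) (not_isFree hij (by simp)) ha hb
      (hp.down i j hij hn) (adj_down hi hj.le) (adj_right hi hj) (adj_down hi hj).symm ?_ ?_ ?_ ?_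
    · intro k l; simp only [Prod.mk.injEq]; omega
    · simp only [hE, vE, Sym2.eq_swap (a := vtx M N (i + 2) (j + 1))]; tauto
    · intro k l hk hl he
      obtain ⟨h', rfl⟩ := (hE_inj hk hl hi.le hj).1 he
      obtain rfl : k = i := by omega
      simp [hij]
    · intro k l hk hl he
      exact absurd he.symm (hE_ne_vE hi.le hj hk hl)
    · simp only [boxVal, hE, vE, Sym2.eq_swap (a := vtx M N (i + 2) (j + 1))]
      exact (by intros; ac_rfl : ∀ a b c d : ℤˣ, a * b * c * d = a * c * (b * d)) _ _ _ _
  | @up B i j _ hij ha hb ih =>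
    simp only [mem_insert, forall_eq_or_imp] at hB
    obtain ⟨⟨hi, hj⟩, hB⟩ := hB
    obtain ⟨u, p, hp⟩ := ih hB
    have hn : (i, j) ∉ B := fun hn => ha _ hn (by simp)
    refine hp.attach hB hi hj (x := (i + 1, j)) (y := (i + 1, j + 1)) (a := (i, j))
      (b := (i, j + 1)) ?_ (not_isFree hij (by simp)) (not_isFree hij (by simp)) ha hb
      (hp.up i j hij hn) (adj_down hi hj.le).symm (adj_right hi.le hj) (adj_down hi hj)
      ?_ ?_ ?_ ?_
    · intro k l; simp only [Prod.mk.injEq]; omega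
    · simp only [hE, vE, Sym2.eq_swap (a := vtx M N (i + 1) j) (b := vtx M N i j)]; tauto
    · intro k l hk hl he
      obtain ⟨h', rfl⟩ := (hE_inj hk hl hi hj).1 he
      obtain rfl : k = i := by omega
      simp [hij]
    · intro k l hk hl he
      exact absurd he.symm (hE_ne_vE hi hj hk hl)
    · simp only [boxVal, hE, vE, Sym2.eq_swap (a := vtx M N (i + 1) j) (b := vtx M N i j)]
      exact (by intros; ac_rfl : ∀ a b c d : ℤˣ, a * b * c * d = c * a * (b * d)) _ _ _ _

theorem isHamiltonianCycle_of_forall_mem {V : Type*} [DecidableEq V] {G : SimpleGraph V} {u : V}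
    {p : G.Walk u u} (hp : p.IsCycle) (h : ∀ v, v ∈ p.support) : p.IsHamiltonianCycle := by
  rw [Walk.isHamiltonianCycle_iff_isCycle_and_support_count_tail_eq_one]
  refine ⟨hp, fun v => List.count_eq_one_of_mem hp.support_nodup ?_⟩
  have hv := h v
  rw [← Walk.cons_tail_support, List.mem_cons] at hv
  rcases hv with rfl | hv
  · exact Walk.end_mem_tail_support hp.not_nil
  · exact hv

/-- A grown set of boxes on which every vertex lies is bounded by a Hamiltonian circle. -/
theorem Grown.exists_isHamiltonianCycle (σ : Signature (grid (M + 1) (N + 1)))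
    {B : Finset (ℕ × ℕ)} (h : Grown B) (hB : ∀ x ∈ B, x.1 < M ∧ x.2 < N)
    (hcov : ∀ i j, i ≤ M → j ≤ N → ¬ IsFree B i j) :
    ∃ (u : _) (p : (grid (M + 1) (N + 1)).Walk u u), p.IsHamiltonianCycle ∧
      walkSign σ p = ∏ x ∈ B, boxVal σ x := by
  obtain ⟨u, p, hp⟩ := h.exists_boundary σ hB
  refine ⟨u, p, ?_, hp.sign⟩
  refine isHamiltonianCycle_of_forall_mem hp.cycle fun v => ?_
  rw [← vtx_val v, hp.support _ _ (by omega) (by omega)]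
  exact hcov _ _ (by omega) (by omega)

/-! ### Building sets of boxes out of horizontal strips -/

theorem Grown.congr {B B' : Finset (ℕ × ℕ)} (h : Grown B)
    (he : ∀ i j, (i, j) ∈ B ↔ (i, j) ∈ B') : Grown B' := by
  have : B = B' := by ext ⟨i, j⟩; exact he i j
  exact this ▸ h

/-- The boxes of row `i` in the columns from `a` to `b`. -/
def strip (i a b : ℕ) : Finset (ℕ × ℕ) := {i} ×ˢ Icc a b

@[simp] theorem mem_strip {i a b k l : ℕ} : (k, l) ∈ strip i a b ↔ k = i ∧ a ≤ l ∧ l ≤ b := by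
  simp only [strip, mem_product, mem_singleton, mem_Icc]

/-- Boxes are added one at a time; the two right-hand vertices of each are new to `B` by `hf` and to
the strip by their column. -/
theorem Grown.strip_right {B : Finset (ℕ × ℕ)} {i j r : ℕ} (h : Grown B) (hij : (i, j) ∈ B)
    (hjr : j ≤ r) (hf : ∀ l, j + 1 < l → l ≤ r + 1 → IsFree B i l ∧ IsFree B (i + 1) l) :
    Grown (B ∪ strip i j r) := by
  induction r, hjr using Nat.le_induction with
  | base =>
    refine h.congr fun k l => ?_
    simp only [mem_union, mem_strip]
    constructor
    · exact Or.inl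
    · rintro (h | ⟨rfl, h1, h2⟩)
      · exact h
      · rwa [le_antisymm h2 h1]
  | succ r hr ih =>
    have hfree : ∀ a, (a = i ∨ a = i + 1) → IsFree (B ∪ strip i j r) a (r + 2) := by
      rintro a ha ⟨k, l⟩ hx hx'
      rcases mem_union.1 hx with hxB | hx
      · rcases ha with rfl | rfl
        · exact (hf (r + 2) (by omega) le_rfl).1 _ hxB hx'
        · exact (hf (r + 2) (by omega) le_rfl).2 _ hxB hx'
      · rw [mem_strip] at hx; simp only at hx'; omega
    refine (Grown.right (ih fun l h1 h2 => hf l h1 (by omega)) (i := i) (j := r)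
      (by simp [hr]) (hfree _ (Or.inl rfl)) (hfree _ (Or.inr rfl))).congr fun k l => ?_
    simp only [mem_insert, mem_union, mem_strip, Prod.mk.injEq]
    by_cases hB : (k, l) ∈ B
    · simp [hB]
    · simp only [hB, false_or]; omega

theorem Grown.strip_left {B : Finset (ℕ × ℕ)} {i j : ℕ} (h : Grown B) (hij : (i, j) ∈ B)
    (d : ℕ) (hd : d ≤ j) (hf : ∀ l, j - d ≤ l → l < j → IsFree B i l ∧ IsFree B (i + 1) l) :
    Grown (B ∪ strip i (j - d) j) := by
  induction d with
  | zero =>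
    refine h.congr fun k l => ?_
    simp only [mem_union, mem_strip]
    constructor
    · exact Or.inl
    · rintro (h | ⟨rfl, h1, h2⟩)
      · exact h
      · rwa [le_antisymm h2 h1]
  | succ d ih =>
    have hfree : ∀ a, (a = i ∨ a = i + 1) → IsFree (B ∪ strip i (j - d) j) a (j - (d + 1)) := by
      rintro a ha ⟨k, l⟩ hx hx'
      rcases mem_union.1 hx with hxB | hx
      · rcases ha with rfl | rfl
        · exact (hf _ le_rfl (by omega)).1 _ hxB hx'
        · exact (hf _ le_rfl (by omega)).2 _ hxB hx'
      · rw [mem_strip] at hx; simp only at hx'; omega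
    refine (Grown.left (ih (by omega) fun l h1 h2 => hf l (by omega) h2) (i := i)
      (j := j - (d + 1)) (mem_union_right _ (by rw [mem_strip]; omega))
      (hfree _ (Or.inl rfl)) (hfree _ (Or.inr rfl))).congr fun k l => ?_
    simp only [mem_insert, mem_union, mem_strip, Prod.mk.injEq]
    by_cases hB : (k, l) ∈ B
    · simp [hB]
    · simp only [hB, false_or]; omega

theorem Grown.strip_both {B : Finset (ℕ × ℕ)} {i j a r : ℕ} (h : Grown B) (hij : (i, j) ∈ B)
    (haj : a ≤ j) (hjr : j ≤ r) (hf : ∀ l, a ≤ l → l ≤ r + 1 → l ≠ j → l ≠ j + 1 →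
      IsFree B i l ∧ IsFree B (i + 1) l) :
    Grown (B ∪ strip i a r) := by
  have h1 := h.strip_right hij hjr fun l h1 h2 => hf l (by omega) h2 (by omega) (by omega)
  refine (h1.strip_left (mem_union_left _ hij) (j - a) (by omega) ?_).congr fun k l => ?_
  · have hfree : ∀ l, j - (j - a) ≤ l → l < j → ∀ b, (b = i ∨ b = i + 1) →
        IsFree (B ∪ strip i j r) b l := by
      rintro l hl hlj b hb ⟨k, l'⟩ hx hx'
      rcases mem_union.1 hx with hxB | hx
      · have := hf l (by omega) (by omega) (by omega) (by omega)
        rcases hb with rfl | rfl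
        · exact this.1 _ hxB hx'
        · exact this.2 _ hxB hx'
      · rw [mem_strip] at hx; simp only at hx'; omega
    exact fun l h1 h2 => ⟨hfree l h1 h2 _ (Or.inl rfl), hfree l h1 h2 _ (Or.inr rfl)⟩
  · simp only [mem_union, mem_strip]
    by_cases hB : (k, l) ∈ B
    · simp [hB]
    · simp only [hB, false_or]; omega

/-- Adding a strip two rows below, joined through the box `(i + 1, j)`. -/
theorem Grown.strip_below {B : Finset (ℕ × ℕ)} {i j a r : ℕ} (h : Grown B) (hij : (i, j) ∈ B)
    (haj : a ≤ j) (hjr : j ≤ r)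
    (hf : ∀ l, a ≤ l → l ≤ r + 1 → IsFree B (i + 2) l ∧ IsFree B (i + 3) l) :
    Grown (insert (i + 1, j) B ∪ strip (i + 2) a r) := by
  have h1 := h.down hij (hf j (by omega) (by omega)).1 (hf (j + 1) (by omega) (by omega)).1
  have h2 := h1.down (i := i + 1) (mem_insert_self _ _)
    (isFree_insert.2 ⟨by simp only; omega, (hf j (by omega) (by omega)).2⟩)
    (isFree_insert.2 ⟨by simp only; omega, (hf (j + 1) (by omega) (by omega)).2⟩)
  refine (h2.strip_both (mem_insert_self _ _) haj hjr fun l h1 h2 h3 h4 => ?_).congr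
    fun k l => ?_
  · simp only [isFree_insert]
    exact ⟨⟨by omega, by omega, (hf l h1 h2).1⟩, ⟨by omega, by omega, (hf l h1 h2).2⟩⟩
  · simp only [mem_union, mem_insert, mem_strip, Prod.mk.injEq]
    by_cases hB : (k, l) ∈ B
    · simp [hB]
    · simp only [hB, or_false]; omega

/-- Adding a strip two rows above, joined through the box `(i + 1, j)`. -/
theorem Grown.strip_above {B : Finset (ℕ × ℕ)} {i j a r : ℕ} (h : Grown B)
    (hij : (i + 2, j) ∈ B) (haj : a ≤ j) (hjr : j ≤ r)
    (hf : ∀ l, a ≤ l → l ≤ r + 1 → IsFree B i l ∧ IsFree B (i + 1) l) :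
    Grown (insert (i + 1, j) B ∪ strip i a r) := by
  have h1 := h.up (i := i + 1) hij (hf j (by omega) (by omega)).2
    (hf (j + 1) (by omega) (by omega)).2
  have h2 := h1.up (i := i) (mem_insert_self _ _)
    (isFree_insert.2 ⟨by simp only; omega, (hf j (by omega) (by omega)).1⟩)
    (isFree_insert.2 ⟨by simp only; omega, (hf (j + 1) (by omega) (by omega)).1⟩)
  refine (h2.strip_both (mem_insert_self _ _) haj hjr fun l h1 h2 h3 h4 => ?_).congr
    fun k l => ?_
  · simp only [isFree_insert]
    exact ⟨⟨by omega, by omega, (hf l h1 h2).1⟩, ⟨by omega, by omega, (hf l h1 h2).2⟩⟩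
  · simp only [mem_union, mem_insert, mem_strip, Prod.mk.injEq]
    by_cases hB : (k, l) ∈ B
    · simp [hB]
    · simp only [hB, or_false]; omega

/-! ### Combs -/

/-- The rows `0, 2, …, 2 * k` and the boxes joining them in column `0`; the last row is cut off
after column `r`. -/
def upperComb (W k r : ℕ) : Finset (ℕ × ℕ) :=
  {x ∈ range (2 * k + 1) ×ˢ range (W + 1) |
    (x.1 < 2 * k ∧ (x.1 % 2 = 0 ∨ x.2 = 0)) ∨ (x.1 = 2 * k ∧ x.2 ≤ r)}

/-- The rows `2 * k + 2, …, 2 * T` and the boxes joining them to each other and to row `2 * k` in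
column `0`. -/
def lowerComb (W k T : ℕ) : Finset (ℕ × ℕ) :=
  {x ∈ range (2 * T + 1) ×ˢ range (W + 1) | 2 * k < x.1 ∧ (x.1 % 2 = 0 ∨ x.2 = 0)}

/-- The rows of even index and column `0`. -/
def comb (W T : ℕ) : Finset (ℕ × ℕ) :=
  {x ∈ range (2 * T + 1) ×ˢ range (W + 1) | x.1 % 2 = 0 ∨ x.2 = 0}

@[simp] theorem mem_upperComb {W k r i j : ℕ} : (i, j) ∈ upperComb W k r ↔ j ≤ W ∧
    ((i < 2 * k ∧ (i % 2 = 0 ∨ j = 0)) ∨ (i = 2 * k ∧ j ≤ r)) := by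
  simp only [upperComb, mem_filter, mem_product, mem_range]; omega

@[simp] theorem mem_lowerComb {W k T i j : ℕ} : (i, j) ∈ lowerComb W k T ↔
    i ≤ 2 * T ∧ j ≤ W ∧ 2 * k < i ∧ (i % 2 = 0 ∨ j = 0) := by
  simp only [lowerComb, mem_filter, mem_product, mem_range]; omega

@[simp] theorem mem_comb {W T i j : ℕ} : (i, j) ∈ comb W T ↔
    i ≤ 2 * T ∧ j ≤ W ∧ (i % 2 = 0 ∨ j = 0) := by
  simp only [comb, mem_filter, mem_product, mem_range]; omega

theorem isFree_iff {B : Finset (ℕ × ℕ)} {a b : ℕ} : IsFree B a b ↔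
    ∀ i j, (i, j) ∈ B → ¬ ((a = i ∨ a = i + 1) ∧ (b = j ∨ b = j + 1)) := by
  simp [IsFree]

/-- The induction extends the comb with its last row full (`r = W`); a shorter last row is needed
where that row is to be cut. -/
theorem grown_upperComb {W k r : ℕ} (hr : r ≤ W) : Grown (upperComb W k r) := by
  induction k generalizing r with
  | zero =>
    refine ((Grown.single (0, 0)).strip_right (mem_singleton_self _) (Nat.zero_le r) ?_).congr ?_
    · simp only [isFree_singleton]
      intro l h1 h2; constructor <;> omega
    · simp only [mem_union, mem_singleton, mem_strip, mem_upperComb, Prod.mk.injEq]; omega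
  | succ k ih =>
    refine ((ih le_rfl).strip_below (i := 2 * k) (j := 0) (a := 0) (r := r) (by simp) le_rfl
      (by omega) ?_).congr ?_
    · simp only [isFree_iff, mem_upperComb]
      intros; (try constructor) <;> (intros; omega)
    · simp only [mem_union, mem_insert, mem_strip, mem_upperComb, Prod.mk.injEq]; omega

/-- Completes a modified comb downwards, so that each exchange need only be built near the rows it
changes. -/
theorem Grown.union_lowerComb {B : Finset (ℕ × ℕ)} {W k T : ℕ} (h : Grown B)
    (hk : (2 * k, 0) ∈ B) (hf : ∀ a b, 2 * k + 2 ≤ a → IsFree B a b) (hkT : k ≤ T) :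
    Grown (B ∪ lowerComb W k T) := by
  induction T, hkT using Nat.le_induction with
  | base =>
    refine h.congr fun i j => ?_
    simp only [mem_union, mem_lowerComb, iff_self_or]
    omega
  | succ T hT ih =>
    refine (ih.strip_below (i := 2 * T) (j := 0) (a := 0) (r := W) ?_ le_rfl (by omega)
      ?_).congr ?_
    · rcases hT.eq_or_lt with rfl | hlt
      · exact mem_union_left _ hk
      · exact mem_union_right _ (by rw [mem_lowerComb]; omega)
    · have hfree : ∀ a l, 2 * T + 2 ≤ a → IsFree (B ∪ lowerComb W k T) a l := by
        rintro a l ha ⟨i, j⟩ hx hx'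
        rcases mem_union.1 hx with hx | hx
        · exact hf a l (by omega) _ hx hx'
        · rw [mem_lowerComb] at hx; simp only at hx'; omega
      exact fun l _ _ => ⟨hfree _ _ (by omega), hfree _ _ (by omega)⟩
    · intro i j
      simp only [mem_union, mem_insert, mem_strip, mem_lowerComb, Prod.mk.injEq]
      by_cases hB : (i, j) ∈ B
      · simp [hB]
      · simp only [hB, false_or]; omega

/-- A grown set of boxes in rows `0, …, 2 * T` and columns `0, …, W` on which all vertices lie. -/
structure IsHamiltonianSet (W T : ℕ) (B : Finset (ℕ × ℕ)) : Prop where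
  grown : Grown B
  bound : ∀ i j, (i, j) ∈ B → i ≤ 2 * T ∧ j ≤ W
  cover : ∀ i j, i ≤ 2 * T + 1 → j ≤ W + 1 → ¬ IsFree B i j

theorem isHamiltonianSet_comb (W T : ℕ) : IsHamiltonianSet W T (comb W T) where
  grown := (grown_upperComb (W := W) (k := T) le_rfl).congr fun i j => by
    simp only [mem_upperComb, mem_comb]; omega
  bound i j := by rw [mem_comb]; omega
  cover i j hi hj hf := by
    rw [isFree_iff] at hf
    -- The even box row containing vertex row `i`; column `j` serves unless `j = W + 1`, and then
    -- column `j - 1` does.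
    have h1 := hf (2 * (i / 2)) j
    have h2 := hf (2 * (i / 2)) (j - 1)
    simp only [mem_comb] at h1 h2
    omega

/-- The boxes joining two rows of the comb may be moved. -/
theorem isHamiltonianSet_move {W T k a : ℕ} (hk : k < T) (ha : a ≤ W) :
    IsHamiltonianSet W T (comb W T \ {(2 * k + 1, 0)} ∪ {(2 * k + 1, a)}) where
  grown := by
    refine (((grown_upperComb (W := W) (k := k) le_rfl).strip_below (i := 2 * k) (j := a) (a := 0)
      (r := W) (by simp; omega) (by omega) ha ?_).union_lowerComb (W := W) (k := k + 1) (T := T)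
      (by simp; omega) ?_ hk).congr ?_
    · simp only [isFree_iff, mem_upperComb]
      intros; (try constructor) <;> (intros; omega)
    · simp only [isFree_iff, mem_union, mem_insert, mem_strip, mem_upperComb, Prod.mk.injEq]
      intros; omega
    · simp only [mem_union, mem_insert, mem_strip, mem_upperComb, mem_lowerComb, mem_sdiff,
        mem_comb, mem_singleton, Prod.mk.injEq]
      omega
  bound i j := by
    simp only [mem_union, mem_sdiff, mem_comb, mem_singleton, Prod.mk.injEq]; omega
  cover i j hi hj hf := by
    rw [isFree_iff] at hf
    have h1 := hf (2 * (i / 2)) j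
    have h2 := hf (2 * (i / 2)) (j - 1)
    simp only [mem_union, mem_sdiff, mem_comb, mem_singleton, Prod.mk.injEq, true_or, and_true]
      at h1 h2
    omega

/-- A row of the comb may be cut if its right part is joined to the row above. -/
theorem isHamiltonianSet_cut_above {W T k j : ℕ} (hk : k < T) (hj : 0 < j) (hjW : j < W) :
    IsHamiltonianSet W T (comb W T \ {(2 * k + 2, j)} ∪ {(2 * k + 1, W)}) where
  grown := by
    -- Row `2 * k + 2` arises in two pieces hung from row `2 * k`: the left one through column `0`,
    -- the right one through column `W`.
    refine ((((grown_upperComb (W := W) (k := k) le_rfl).strip_below (i := 2 * k) (j := 0)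
      (a := 0) (r := j - 1) (by simp) le_rfl (by omega) ?_).strip_below (i := 2 * k) (j := W)
      (a := j + 1) (r := W) (by simp) (by omega) le_rfl ?_).union_lowerComb (W := W) (k := k + 1)
      (T := T) (by simp; omega) ?_ hk).congr ?_
    · simp only [isFree_iff, mem_upperComb]
      intros; (try constructor) <;> (intros; omega)
    · simp only [isFree_iff, mem_union, mem_insert, mem_strip, mem_upperComb, Prod.mk.injEq]
      intros; (try constructor) <;> (intros; omega)
    · simp only [isFree_iff, mem_union, mem_insert, mem_strip, mem_upperComb, Prod.mk.injEq]
      intros; omega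
    · simp only [mem_union, mem_insert, mem_strip, mem_upperComb, mem_lowerComb, mem_sdiff,
        mem_comb, mem_singleton, Prod.mk.injEq]
      omega
  bound i l := by
    simp only [mem_union, mem_sdiff, mem_comb, mem_singleton, Prod.mk.injEq]; omega
  cover i l hi hl hf := by
    rw [isFree_iff] at hf
    have h1 := hf (2 * (i / 2)) l
    have h2 := hf (2 * (i / 2)) (l - 1)
    simp only [mem_union, mem_sdiff, mem_comb, mem_singleton, Prod.mk.injEq, true_or, and_true]
      at h1 h2
    omega

/-- A row of the comb may be cut if its right part is joined to the row below. -/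
theorem isHamiltonianSet_cut_below {W T k j : ℕ} (hk : k < T) (hj : 0 < j) (hjW : j < W) :
    IsHamiltonianSet W T (comb W T \ {(2 * k, j)} ∪ {(2 * k + 1, W)}) where
  grown := by
    -- Row `2 * k` stops before column `j`. Its right part is added last, from row `2 * k + 2`
    -- upwards through column `W`.
    refine ((((grown_upperComb (W := W) (k := k) (r := j - 1) (by omega)).strip_below (i := 2 * k)
      (j := 0) (a := 0) (r := W) (by simp) le_rfl (by omega) ?_).strip_above (i := 2 * k) (j := W)
      (a := j + 1) (r := W) (by simp) (by omega) le_rfl ?_).union_lowerComb (W := W) (k := k + 1)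
      (T := T) (by simp; omega) ?_ hk).congr ?_
    · simp only [isFree_iff, mem_upperComb]
      intros; (try constructor) <;> (intros; omega)
    · simp only [isFree_iff, mem_union, mem_insert, mem_strip, mem_upperComb, Prod.mk.injEq]
      intros; (try constructor) <;> (intros; omega)
    · simp only [isFree_iff, mem_union, mem_insert, mem_strip, mem_upperComb, Prod.mk.injEq]
      intros; omega
    · simp only [mem_union, mem_insert, mem_strip, mem_upperComb, mem_lowerComb, mem_sdiff,
        mem_comb, mem_singleton, Prod.mk.injEq]
      omega
  bound i l := by
    simp only [mem_union, mem_sdiff, mem_comb, mem_singleton, Prod.mk.injEq]; omega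
  cover i l hi hl hf := by
    rw [isFree_iff] at hf
    have h1 := hf (2 * (i / 2)) l
    have h2 := hf (2 * (i / 2)) (l - 1)
    simp only [mem_union, mem_sdiff, mem_comb, mem_singleton, Prod.mk.injEq, true_or, and_true]
      at h1 h2
    omega

/-- The first two boxes of an inner row of the comb may be removed. -/
theorem isHamiltonianSet_trim_left {W T k : ℕ} (hk : k + 1 < T) (hW : 2 ≤ W) :
    IsHamiltonianSet W T (comb W T \ {(2 * k + 2, 0), (2 * k + 2, 1)} ∪
      {(2 * k + 1, W), (2 * k + 3, W)}) where
  grown := by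
    -- The old connectors in column `0` become teeth hanging from rows `2 * k` and `2 * k + 4`,
    -- while the joins move to column `W`. Two boxes must go: otherwise a tooth and the shortened
    -- row would meet at a vertex.
    refine ((((((grown_upperComb (W := W) (k := k) le_rfl).down (i := 2 * k) (j := 0) (by simp)
      ?_ ?_).strip_below (i := 2 * k) (j := W) (a := 2) (r := W) (by simp) hW le_rfl
      ?_).strip_below (i := 2 * k + 2) (j := W) (a := 0) (r := W) (by simp; omega) (by omega) le_rfl
      ?_).up (i := 2 * k + 3) (j := 0) (by simp) ?_ ?_).union_lowerComb (W := W)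
      (k := k + 2) (T := T) (by simp; omega) ?_ hk).congr ?_
    · simp only [isFree_iff, mem_upperComb]
      intros; omega
    · simp only [isFree_iff, mem_upperComb]
      intros; omega
    · simp only [isFree_iff, mem_insert, mem_upperComb, Prod.mk.injEq]
      intros; (try constructor) <;> (intros; omega)
    · simp only [isFree_iff, mem_union, mem_insert, mem_strip, mem_upperComb, Prod.mk.injEq]
      intros; (try constructor) <;> (intros; omega)
    · simp only [isFree_iff, mem_union, mem_insert, mem_strip, mem_upperComb, Prod.mk.injEq]
      intros; omega
    · simp only [isFree_iff, mem_union, mem_insert, mem_strip, mem_upperComb, Prod.mk.injEq]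
      intros; omega
    · simp only [isFree_iff, mem_union, mem_insert, mem_strip, mem_upperComb, Prod.mk.injEq]
      intros; omega
    · simp only [mem_union, mem_insert, mem_strip, mem_upperComb, mem_lowerComb, mem_sdiff,
        mem_comb, mem_singleton, Prod.mk.injEq]
      omega
  bound i j := by
    simp only [mem_union, mem_sdiff, mem_comb, mem_insert, mem_singleton, Prod.mk.injEq]; omega
  cover i j hi hj hf := by
    rw [isFree_iff] at hf
    have h1 := hf (2 * (i / 2)) j
    have h2 := hf (2 * (i / 2)) (j - 1)
    have h3 := hf (2 * k + 1) 0
    have h4 := hf (2 * k + 3) 0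
    simp only [mem_union, mem_sdiff, mem_comb, mem_insert, mem_singleton, Prod.mk.injEq, true_or,
      or_true, and_true, true_and] at h1 h2 h3 h4
    omega

/-- The last two boxes of an inner row of the comb may be removed. -/
theorem isHamiltonianSet_trim_right {W T k : ℕ} (hk : k + 1 < T) (hW : 2 ≤ W) :
    IsHamiltonianSet W T (comb W T \ {(2 * k + 2, W), (2 * k + 2, W - 1)} ∪
      {(2 * k + 1, W), (2 * k + 3, W)}) where
  grown := by
    -- Here the added boxes in column `W` are the teeth, and the joins stay in column `0`.
    refine ((((((grown_upperComb (W := W) (k := k) le_rfl).down (i := 2 * k) (j := W) (by simp)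
      ?_ ?_).strip_below (i := 2 * k) (j := 0) (a := 0) (r := W - 2) (by simp) le_rfl (by omega)
      ?_).strip_below (i := 2 * k + 2) (j := 0) (a := 0) (r := W) (by simp) le_rfl (by omega)
      ?_).up (i := 2 * k + 3) (j := W) (by simp) ?_ ?_).union_lowerComb (W := W)
      (k := k + 2) (T := T) (by simp; omega) ?_ hk).congr ?_
    · simp only [isFree_iff, mem_upperComb]
      intros; omega
    · simp only [isFree_iff, mem_upperComb]
      intros; omega
    · simp only [isFree_iff, mem_insert, mem_upperComb, Prod.mk.injEq]
      intros; (try constructor) <;> (intros; omega)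
    · simp only [isFree_iff, mem_union, mem_insert, mem_strip, mem_upperComb, Prod.mk.injEq]
      intros; (try constructor) <;> (intros; omega)
    · simp only [isFree_iff, mem_union, mem_insert, mem_strip, mem_upperComb, Prod.mk.injEq]
      intros; omega
    · simp only [isFree_iff, mem_union, mem_insert, mem_strip, mem_upperComb, Prod.mk.injEq]
      intros; omega
    · simp only [isFree_iff, mem_union, mem_insert, mem_strip, mem_upperComb, Prod.mk.injEq]
      intros; omega
    · simp only [mem_union, mem_insert, mem_strip, mem_upperComb, mem_lowerComb, mem_sdiff,
        mem_comb, mem_singleton, Prod.mk.injEq]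
      omega
  bound i j := by
    simp only [mem_union, mem_sdiff, mem_comb, mem_insert, mem_singleton, Prod.mk.injEq]; omega
  cover i j hi hj hf := by
    rw [isFree_iff] at hf
    have h1 := hf (2 * (i / 2)) j
    have h2 := hf (2 * (i / 2)) (j - 1)
    have h3 := hf (2 * k + 1) W
    have h4 := hf (2 * k + 3) W
    simp only [mem_union, mem_sdiff, mem_comb, mem_insert, mem_singleton, Prod.mk.injEq, true_or,
      or_true, and_true, true_imp_iff] at h1 h2 h3 h4
    omega

/-! ### Comparing boxes -/

section

variable {W T : ℕ} {σ : Signature (grid (2 * T + 1 + 1) (W + 1 + 1))}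

theorem IsHamiltonianSet.exists_isHamiltonianCycle {B : Finset (ℕ × ℕ)}
    (h : IsHamiltonianSet W T B) (σ : Signature (grid (2 * T + 1 + 1) (W + 1 + 1))) :
    ∃ (u : _) (p : (grid (2 * T + 1 + 1) (W + 1 + 1)).Walk u u), p.IsHamiltonianCycle ∧
      walkSign σ p = ∏ x ∈ B, boxVal σ x :=
  h.grown.exists_isHamiltonianCycle σ
    (fun x hx => by have := h.bound x.1 x.2 hx; omega)
    (fun i j hi hj => h.cover i j (by omega) (by omega))

/-- If two Hamiltonian circles have the same sign, the boxes in which their interiors differ have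
the same product. -/
theorem prod_eq_of_isHamiltonianSet (hσ : AllHamiltonianSameSign σ) {R A : Finset (ℕ × ℕ)}
    (h : IsHamiltonianSet W T (comb W T \ R ∪ A)) (hR : ∀ x ∈ R, x ∈ comb W T)
    (hA : ∀ x ∈ A, x ∉ comb W T) :
    ∏ x ∈ A, boxVal σ x = ∏ x ∈ R, boxVal σ x := by
  obtain ⟨u, p, hp, hps⟩ := h.exists_isHamiltonianCycle σ
  obtain ⟨v, q, hq, hqs⟩ := (isHamiltonianSet_comb W T).exists_isHamiltonianCycle σ
  have := hσ u v p q hp hq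
  rw [hps, hqs, prod_union, ← prod_sdiff (s₁ := R) hR] at this
  · exact mul_left_cancel this
  · exact Finset.disjoint_left.2 fun x hx hx' => hA x hx' (mem_sdiff.1 hx).1

theorem boxVal_odd_row (hσ : AllHamiltonianSameSign σ) {k a : ℕ} (hk : k < T) (ha : a ≤ W) :
    boxVal σ (2 * k + 1, a) = boxVal σ (2 * k + 1, 0) := by
  rcases Nat.eq_zero_or_pos a with rfl | ha'
  · rfl
  · simpa using prod_eq_of_isHamiltonianSet hσ (isHamiltonianSet_move hk ha)
      (by simp; omega)
      (by simp only [mem_singleton, forall_eq, mem_comb]; omega)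

theorem boxVal_row_below (hσ : AllHamiltonianSameSign σ) {k j : ℕ} (hk : k < T) (hj : 0 < j)
    (hjW : j < W) : boxVal σ (2 * k + 2, j) = boxVal σ (2 * k + 1, 0) := by
  rw [← boxVal_odd_row hσ hk le_rfl, eq_comm]
  simpa using prod_eq_of_isHamiltonianSet hσ (isHamiltonianSet_cut_above hk hj hjW)
    (by simp only [mem_singleton, forall_eq, mem_comb]; omega)
    (by simp only [mem_singleton, forall_eq, mem_comb]; omega)

theorem boxVal_row_above (hσ : AllHamiltonianSameSign σ) {k j : ℕ} (hk : k < T) (hj : 0 < j)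
    (hjW : j < W) : boxVal σ (2 * k, j) = boxVal σ (2 * k + 1, 0) := by
  rw [← boxVal_odd_row hσ hk le_rfl, eq_comm]
  simpa using prod_eq_of_isHamiltonianSet hσ (isHamiltonianSet_cut_below hk hj hjW)
    (by simp only [mem_singleton, forall_eq, mem_comb]; omega)
    (by simp only [mem_singleton, forall_eq, mem_comb]; omega)

/-- Consecutive odd rows are compared through the box in column `1` of the even row between them; it
is not at an end of its row because `2 ≤ W`. -/
theorem boxVal_odd_row_first (hσ : AllHamiltonianSameSign σ) (hW : 2 ≤ W) {k : ℕ} (hk : k < T) :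
    boxVal σ (2 * k + 1, 0) = boxVal σ (1, 0) := by
  induction k with
  | zero => rfl
  | succ k ih =>
    rw [← ih (by omega), ← boxVal_row_above hσ hk one_pos (by omega),
      ← boxVal_row_below hσ (k := k) (by omega) one_pos (by omega), Nat.mul_succ]

/-- Of the four boxes exchanged, three are already known to have the common sign. -/
theorem boxVal_left (hσ : AllHamiltonianSameSign σ) (hW : 2 ≤ W) {k : ℕ} (hk : k + 1 < T) :
    boxVal σ (2 * k + 2, 0) = boxVal σ (1, 0) := by
  have h := prod_eq_of_isHamiltonianSet hσ (isHamiltonianSet_trim_left hk hW)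
    (by simp only [mem_insert, mem_singleton, forall_eq_or_imp, forall_eq, mem_comb]; omega)
    (by simp only [mem_insert, mem_singleton, forall_eq_or_imp, forall_eq, mem_comb]; omega)
  rw [prod_pair (by simp), prod_pair (by simp), boxVal_odd_row hσ (by omega) le_rfl,
    show 2 * k + 3 = 2 * (k + 1) + 1 by ring, boxVal_odd_row hσ hk le_rfl,
    boxVal_row_below hσ (by omega) one_pos (by omega), boxVal_odd_row_first hσ hW (by omega),
    boxVal_odd_row_first hσ hW hk] at h
  exact (mul_right_cancel h).symm

theorem boxVal_right (hσ : AllHamiltonianSameSign σ) (hW : 2 ≤ W) {k : ℕ} (hk : k + 1 < T) :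
    boxVal σ (2 * k + 2, W) = boxVal σ (1, 0) := by
  have h := prod_eq_of_isHamiltonianSet hσ (isHamiltonianSet_trim_right hk hW)
    (by simp only [mem_insert, mem_singleton, forall_eq_or_imp, forall_eq, mem_comb]; omega)
    (by simp only [mem_insert, mem_singleton, forall_eq_or_imp, forall_eq, mem_comb]; omega)
  rw [prod_pair (by simp), prod_pair (by simp; omega), boxVal_odd_row hσ (by omega) le_rfl,
    show 2 * k + 3 = 2 * (k + 1) + 1 by ring, boxVal_odd_row hσ hk le_rfl,
    boxVal_row_below hσ (k := k) (j := W - 1) (by omega) (by omega) (by omega),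
    boxVal_odd_row_first hσ hW (by omega), boxVal_odd_row_first hσ hW hk] at h
  exact (mul_right_cancel h).symm

theorem boxVal_eq (hσ : AllHamiltonianSameSign σ) (hW : 2 ≤ W) (hT : 0 < T) {i j : ℕ}
    (hi : i ≤ 2 * T) (hj : j ≤ W) (hc : ¬ ((i = 0 ∨ i = 2 * T) ∧ (j = 0 ∨ j = W))) :
    boxVal σ (i, j) = boxVal σ (1, 0) := by
  rcases Nat.even_or_odd' i with ⟨k, rfl | rfl⟩
  · by_cases hjc : j = 0 ∨ j = W
    -- At the end of an even row, `hc` excludes the first row.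
    · obtain ⟨k, rfl⟩ : ∃ l, k = l + 1 := ⟨k - 1, by omega⟩
      rcases hjc with rfl | rfl
      · exact boxVal_left hσ hW (by omega)
      · exact boxVal_right hσ hW (by omega)
    · rcases Nat.lt_or_ge k T with hk | hk
      · rw [boxVal_row_above hσ hk (by omega) (by omega), boxVal_odd_row_first hσ hW hk]
      -- The last row has no odd row below it, so it is compared with the one above.
      · obtain ⟨k, rfl⟩ : ∃ l, k = l + 1 := ⟨k - 1, by omega⟩
        rw [Nat.mul_succ, boxVal_row_below hσ (by omega) (by omega) (by omega),
          boxVal_odd_row_first hσ hW (by omega)]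
  · rw [boxVal_odd_row hσ (by omega) hj, boxVal_odd_row_first hσ hW (by omega)]

end

end SignedGrid

/-! ### The main theorem -/

theorem mainTheorem4 (m n : ℕ) (hm_even : Even m) (hm : 3 < m) (hn : 3 < n)
    (σ : SignedGrid.Signature (SignedGrid.grid m n)) :
    SignedGrid.AllHamiltonianSameSign σ ↔
      ∀ b c : SignedGrid.Box m n, ¬ SignedGrid.IsCorner b → ¬ SignedGrid.IsCorner c →
        SignedGrid.boxSign σ b = SignedGrid.boxSign σ c := by
  obtain ⟨t, ht⟩ := hm_even
  obtain ⟨T, rfl⟩ : ∃ T, t = T + 1 := ⟨t - 1, by omega⟩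
  -- Evenness of `m` gives `2 * T + 1` rows of boxes, so the comb has a full row at the top and at
  -- the bottom.
  obtain rfl : m = 2 * T + 1 + 1 := by omega
  obtain ⟨W, rfl⟩ : ∃ W, n = W + 1 + 1 := ⟨n - 2, by omega⟩
  constructor
  · intro hσ
    have key : ∀ b : SignedGrid.Box (2 * T + 1 + 1) (W + 1 + 1), ¬ SignedGrid.IsCorner b →
        SignedGrid.boxSign σ b = SignedGrid.boxVal σ (1, 0) := by
      rintro ⟨⟨i, hi⟩, ⟨j, hj⟩⟩ hb
      rw [SignedGrid.boxSign_eq]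
      have hi' : i ≤ 2 * T := by omega
      have hj' : j ≤ W := by omega
      exact SignedGrid.boxVal_eq hσ (by omega) (by omega) hi' hj' fun h =>
        hb ⟨h.1.imp_right (congrArg Nat.succ), h.2.imp_right (congrArg Nat.succ)⟩
    intro b c hb hc
    rw [key b hb, key c hc]
  · intro h
    -- Box `(1, 0)` serves as reference: with `m > 3` there are at least three rows of boxes, so it
    -- is not a corner.
    refine SignedGrid.allHamiltonianSameSign_of_boxes (by omega) (by omega) σ
      (SignedGrid.boxSign σ (⟨1, by omega⟩, ⟨0, by omega⟩)) fun b hb => h _ _ hb ?_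
    rw [SignedGrid.isCorner_iff]
    simp only
    omega
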